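/- All vector spaces and algebras are complex, all Banach spaces are infinite-dimensional, and "operator" means continuous linear map; $\mathcal B(X,Y)$ is the space of operators $X\to Y$. An *ideal of operators* $\mathcal J$ assigns to each pair $(X,Y)$ of Banach spaces a linear subspace $\mathcal J(X,Y)\subseteq\mathcal B(X,Y)$ such that $TSR\in\mathcal J(W,Z)$ whenever $R\in\mathcal B(W,X)$, $S\in\mathcal J(X,Y)$, $T\in\mathcal B(Y,Z)$; we write $\mathcal J(X)=\mathcal J(X,X)$. It is *closed* if every $\mathcal J(X,Y)$ is norm closed in $\mathcal B(X,Y)$, and *non-zero* if $\mathcal J(X,Y)\ne\{0\}$ for all $X,Y$. (A non-zero ideal contains all finite-rank operators.) An operator $S:X\to Y$ is *strictly singular* if every linear subspace of $X$ on which $S$ is bounded below is finite-dimensional. Let $\mathcal F(X)$ be the algebra of finite-rank operators on $X$. For a ring $A$, call idempotent matrices $P\in M_m(A)$ and $Q\in M_n(A)$ equivalent if $P=RT$ and $Q=TR$ for some $R\in M_{m,n}(A)$, $T\in M_{n,m}(A)$; the equivalence classes of idempotent matrices of all finite sizes form an abelian monoid $V(A)$ under $[P]+[Q]=[P\oplus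 Q]$. If $A$ is unital, $K_0(A)$ is the Grothendieck group of $V(A)$, and $[P]_0$ is the image of $[P]$ in it. For a non-unital algebra $A$, let $A^\sharp$ be $A$ with an identity $I$ adjoined and $s:A^\sharp\to A^\sharp$, $s(a+\zeta I)=\zeta I$ for $a\in A$, $\zeta\in\mathbb C$; let $s_n$ be the entrywise map on $M_n(A^\sharp)$. Then $K_0(A)$ is the subgroup $\{[P]_0-[s_n(P)]_0 : n\in\mathbb N,\ P\in M_n(A^\sharp),\ P^2=P\}$ of $K_0(A^\sharp)$. An idempotent matrix $P$ over $A$ itself defines the element $[P]_0$ of $K_0(A)$, since $s_n(P)=0$. **Theorem.** Let $\mathcal J$ be a closed, non-zero ideal of operators all of whose members are strictly singular, and let $X$ be an infinite-dimensional complex Banach space. Let $n\in\mathbb N$ and let $Q\in M_n(\mathcal F(X))$ be an idempotent matrix which, as an operator on $X^n$, has rank one. Then the map $$\nu\longmapsto \nu\,[Q]_0,\qquad \mathbb Z\longrightarrow K_0(\mathcal J(X)),$$ is a group isomorphism. -/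

import Mathlib

universe u v

namespace OpK

/-! ### Banach spaces, operator ideals, strictly singular operators -/

/-- The standing class of spaces: infinite-dimensional complex Banach spaces. -/
class InfDimBanach (X : Type u) [NormedAddCommGroup X] [NormedSpace ℂ X] : Prop
    extends CompleteSpace X where
  not_finiteDimensional : ¬ FiniteDimensional ℂ X

/-- An ideal of operators: an assignment of a linear subspace of `X →L[ℂ] Y` to each pair of
(infinite-dimensional, complex) Banach spaces, stable under composition with arbitrary
operators on both sides. -/
structure OperatorIdeal where
  ops : ∀ (X Y : Type u) [NormedAddCommGroup X] [NormedSpace ℂ X] [InfDimBanach X]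
    [NormedAddCommGroup Y] [NormedSpace ℂ Y] [InfDimBanach Y], Submodule ℂ (X →L[ℂ] Y)
  comp_mem : ∀ (W X Y Z : Type u)
    [NormedAddCommGroup W] [NormedSpace ℂ W] [InfDimBanach W]
    [NormedAddCommGroup X] [NormedSpace ℂ X] [InfDimBanach X]
    [NormedAddCommGroup Y] [NormedSpace ℂ Y] [InfDimBanach Y]
    [NormedAddCommGroup Z] [NormedSpace ℂ Z] [InfDimBanach Z]
    (R : W →L[ℂ] X) (S : X →L[ℂ] Y) (T : Y →L[ℂ] Z), S ∈ ops X Y →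
      T.comp (S.comp R) ∈ ops W Z

/-- `S : X → Y` is strictly singular if every (not necessarily closed) linear subspace of `X`
on which `S` is bounded below is finite-dimensional. -/
def IsStrictlySingular {X Y : Type u} [NormedAddCommGroup X] [NormedSpace ℂ X]
    [NormedAddCommGroup Y] [NormedSpace ℂ Y] (S : X →L[ℂ] Y) : Prop :=
  ∀ V : Submodule ℂ X, (∃ c : ℝ, 0 < c ∧ ∀ x ∈ V, c * ‖x‖ ≤ ‖S x‖) → FiniteDimensional ℂ V

namespace OperatorIdeal

/-- All components of the ideal are closed in the operator norm. -/
def Closed (J : OperatorIdeal.{u}) : Prop :=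
  ∀ (X Y : Type u) [NormedAddCommGroup X] [NormedSpace ℂ X] [InfDimBanach X]
    [NormedAddCommGroup Y] [NormedSpace ℂ Y] [InfDimBanach Y],
    IsClosed (J.ops X Y : Set (X →L[ℂ] Y))

/-- All components of the ideal are different from `{0}`. -/
def NonZero (J : OperatorIdeal.{u}) : Prop :=
  ∀ (X Y : Type u) [NormedAddCommGroup X] [NormedSpace ℂ X] [InfDimBanach X]
    [NormedAddCommGroup Y] [NormedSpace ℂ Y] [InfDimBanach Y], J.ops X Y ≠ ⊥

/-- The ideal consists of strictly singular operators. -/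
def ContainedInStrictlySingular (J : OperatorIdeal.{u}) : Prop :=
  ∀ (X Y : Type u) [NormedAddCommGroup X] [NormedSpace ℂ X] [InfDimBanach X]
    [NormedAddCommGroup Y] [NormedSpace ℂ Y] [InfDimBanach Y],
    ∀ S ∈ J.ops X Y, IsStrictlySingular S

/-- The algebra `J(X) = J(X, X)`, a (non-unital) subalgebra of the algebra of all operators
on `X`. -/
def alg (J : OperatorIdeal.{u}) (X : Type u) [NormedAddCommGroup X] [NormedSpace ℂ X]
    [InfDimBanach X] : NonUnitalSubalgebra ℂ (X →L[ℂ] X) where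
  carrier := J.ops X X
  add_mem' ha hb := (J.ops X X).add_mem ha hb
  zero_mem' := (J.ops X X).zero_mem
  smul_mem' c _ ha := (J.ops X X).smul_mem c ha
  mul_mem' {a b} ha _ := J.comp_mem X X X X b a (ContinuousLinearMap.id ℂ X) ha

end OperatorIdeal

/-- The algebra of finite-rank operators on `X`. -/
def finiteRank (X : Type u) [NormedAddCommGroup X] [NormedSpace ℂ X] :
    NonUnitalSubalgebra ℂ (X →L[ℂ] X) where
  carrier := {A | FiniteDimensional ℂ (LinearMap.range (A : X →ₗ[ℂ] X))}
  add_mem' {a b} ha hb := by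
    have : FiniteDimensional ℂ (LinearMap.range (a : X →ₗ[ℂ] X)) := ha
    have : FiniteDimensional ℂ (LinearMap.range (b : X →ₗ[ℂ] X)) := hb
    refine Submodule.finiteDimensional_of_le
      (S₂ := LinearMap.range (a : X →ₗ[ℂ] X) ⊔ LinearMap.range (b : X →ₗ[ℂ] X)) ?_
    rintro _ ⟨x, rfl⟩
    exact Submodule.add_mem_sup ⟨x, rfl⟩ ⟨x, rfl⟩
  zero_mem' := by
    refine Submodule.finiteDimensional_of_le (S₂ := (⊥ : Submodule ℂ X)) ?_
    rintro _ ⟨x, rfl⟩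
    simp
  smul_mem' c a ha := by
    have : FiniteDimensional ℂ (LinearMap.range (a : X →ₗ[ℂ] X)) := ha
    refine Submodule.finiteDimensional_of_le (S₂ := LinearMap.range (a : X →ₗ[ℂ] X)) ?_
    rintro _ ⟨x, rfl⟩
    exact Submodule.smul_mem _ c ⟨x, rfl⟩
  mul_mem' {a b} ha _ := by
    have : FiniteDimensional ℂ (LinearMap.range (a : X →ₗ[ℂ] X)) := ha
    refine Submodule.finiteDimensional_of_le (S₂ := LinearMap.range (a : X →ₗ[ℂ] X)) ?_
    rintro _ ⟨x, rfl⟩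
    exact ⟨b x, rfl⟩

/-- A non-zero ideal of operators contains the finite-rank operators. -/
theorem OperatorIdeal.NonZero.finiteRank_le {J : OperatorIdeal.{u}} (hJ : J.NonZero)
    (X : Type u) [NormedAddCommGroup X] [NormedSpace ℂ X] [InfDimBanach X] :
    finiteRank X ≤ J.alg X := by
  intro A hA
  have hfin : FiniteDimensional ℂ (LinearMap.range (A : X →ₗ[ℂ] X)) := hA
  obtain ⟨S, hS, hS0⟩ := (Submodule.ne_bot_iff _).1 (hJ X X)
  obtain ⟨x₀, hx₀⟩ : ∃ x, S x ≠ 0 := by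
    by_contra! h
    exact hS0 (ContinuousLinearMap.ext h)
  obtain ⟨g, hg⟩ := SeparatingDual.exists_eq_one (R := ℂ) hx₀
  have key : ∀ (φ : X →L[ℂ] ℂ) (y : X), φ.smulRight y ∈ J.ops X X := by
    intro φ y
    have h := J.comp_mem X X X X (φ.smulRight x₀) S (g.smulRight y) hS
    have e : (g.smulRight y).comp (S.comp (φ.smulRight x₀)) = φ.smulRight y := by
      ext x
      simp [hg]
    rwa [e] at h
  let b := Module.finBasis ℂ (LinearMap.range (A : X →ₗ[ℂ] X))
  let A' : X →L[ℂ] LinearMap.range (A : X →ₗ[ℂ] X) :=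
    A.codRestrict _ (fun x => ⟨x, rfl⟩)
  have e : A = ∑ i, ((LinearMap.toContinuousLinearMap (b.coord i)).comp A').smulRight
      (b i : X) := by
    ext x
    have h := congrArg (Subtype.val) (b.sum_repr (A' x))
    simp only [Submodule.coe_sum, Submodule.coe_smul] at h
    simp only [_root_.sum_apply, ContinuousLinearMap.smulRight_apply,
      ContinuousLinearMap.comp_apply, LinearMap.coe_toContinuousLinearMap', Module.Basis.coord_apply]
    rw [h]
    rfl
  change A ∈ J.ops X X
  rw [e]
  exact Submodule.sum_mem _ fun i _ => key _ _

/-- The operator on the direct sum `X^n` (with the maximum norm) that corresponds to an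
`n × n` matrix of operators on `X`. -/
noncomputable def matrixOp {X : Type u} [NormedAddCommGroup X] [NormedSpace ℂ X] {n : ℕ}
    (T : Matrix (Fin n) (Fin n) (X →L[ℂ] X)) : (Fin n → X) →L[ℂ] (Fin n → X) :=
  ContinuousLinearMap.pi fun k => ∑ l, (T k l).comp (ContinuousLinearMap.proj l)

/-! ### The semigroup of classes of idempotent matrices -/

section Idempotents

/-- `P ∼₀ Q` for square matrices of possibly different sizes. -/
def Equiv₀ {m n A : Type*} [Fintype m] [Fintype n] [NonUnitalRing A]
    (P : Matrix m m A) (Q : Matrix n n A) : Prop :=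
  ∃ (R : Matrix m n A) (T : Matrix n m A), P = R * T ∧ Q = T * R

theorem Equiv₀.refl {m A : Type*} [Fintype m] [NonUnitalRing A] {P : Matrix m m A}
    (hP : IsIdempotentElem P) : Equiv₀ P P := ⟨P, P, hP.symm, hP.symm⟩

theorem Equiv₀.symm {m n A : Type*} [Fintype m] [Fintype n] [NonUnitalRing A]
    {P : Matrix m m A} {Q : Matrix n n A} (h : Equiv₀ P Q) : Equiv₀ Q P := by
  obtain ⟨R, T, h₁, h₂⟩ := h
  exact ⟨T, R, h₂, h₁⟩

theorem Equiv₀.trans {m n k A : Type*} [Fintype m] [Fintype n] [Fintype k] [NonUnitalRing A]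
    {P : Matrix m m A} {Q : Matrix n n A} {S : Matrix k k A}
    (hP : IsIdempotentElem P) (hS : IsIdempotentElem S)
    (h : Equiv₀ P Q) (h' : Equiv₀ Q S) : Equiv₀ P S := by
  obtain ⟨R, T, h₁, h₂⟩ := h
  obtain ⟨R', T', h₁', h₂'⟩ := h'
  refine ⟨R * R', T' * T, ?_, ?_⟩
  · calc P = P * P := hP.symm
      _ = R * (T * R) * T := by rw [h₁]; simp only [Matrix.mul_assoc]
      _ = R * R' * (T' * T) := by rw [← h₂, h₁']; simp only [Matrix.mul_assoc]
  · calc S = S * S := hS.symm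
      _ = T' * (R' * T') * R' := by rw [h₂']; simp only [Matrix.mul_assoc]
      _ = T' * T * (R * R') := by rw [← h₁', h₂]; simp only [Matrix.mul_assoc]

theorem Equiv₀.reindex {m n A : Type*} [Fintype m] [Fintype n] [NonUnitalRing A]
    {P : Matrix m m A} (hP : IsIdempotentElem P) (e : m ≃ n) :
    Equiv₀ P (Matrix.reindex e e P) := by
  refine ⟨P.submatrix id e.symm, P.submatrix e.symm id, ?_, ?_⟩
  · rw [Matrix.submatrix_mul_equiv]
    simpa using hP.symm
  · have h := Matrix.submatrix_mul_equiv P P e.symm (Equiv.refl m) e.symm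
    simp only [Equiv.coe_refl] at h
    rw [h, hP.eq]
    rfl

theorem isIdempotentElem_reindex {m n A : Type*} [Fintype m] [Fintype n] [NonUnitalRing A]
    {P : Matrix m m A} (hP : IsIdempotentElem P) (e : m ≃ n) :
    IsIdempotentElem (Matrix.reindex e e P) := by
  change Matrix.submatrix P e.symm e.symm * Matrix.submatrix P e.symm e.symm = _
  rw [Matrix.submatrix_mul_equiv, hP.eq]
  rfl

theorem isIdempotentElem_fromBlocks {m n A : Type*} [Fintype m] [Fintype n] [NonUnitalRing A]
    {P : Matrix m m A} {Q : Matrix n n A} (hP : IsIdempotentElem P) (hQ : IsIdempotentElem Q) :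
    IsIdempotentElem (Matrix.fromBlocks P 0 0 Q) := by
  simp [IsIdempotentElem, Matrix.fromBlocks_multiply, hP.eq, hQ.eq]

theorem Equiv₀.fromBlocks {m n m' n' A : Type*} [Fintype m] [Fintype n] [Fintype m']
    [Fintype n'] [NonUnitalRing A] {P : Matrix m m A} {Q : Matrix n n A}
    {P' : Matrix m' m' A} {Q' : Matrix n' n' A} (h : Equiv₀ P P') (h' : Equiv₀ Q Q') :
    Equiv₀ (Matrix.fromBlocks P 0 0 Q) (Matrix.fromBlocks P' 0 0 Q') := by
  obtain ⟨R, T, rfl, rfl⟩ := h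
  obtain ⟨R', T', rfl, rfl⟩ := h'
  exact ⟨Matrix.fromBlocks R 0 0 R', Matrix.fromBlocks T 0 0 T',
    by simp [Matrix.fromBlocks_multiply], by simp [Matrix.fromBlocks_multiply]⟩

/-- `P ⊕ Q`, the block diagonal matrix with blocks `P` and `Q`. -/
def blockSum {m n : ℕ} {A : Type*} [NonUnitalRing A] (P : Matrix (Fin m) (Fin m) A)
    (Q : Matrix (Fin n) (Fin n) A) : Matrix (Fin (m + n)) (Fin (m + n)) A :=
  Matrix.reindex finSumFinEquiv finSumFinEquiv (Matrix.fromBlocks P 0 0 Q)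

theorem isIdempotentElem_blockSum {m n : ℕ} {A : Type*} [NonUnitalRing A]
    {P : Matrix (Fin m) (Fin m) A} {Q : Matrix (Fin n) (Fin n) A}
    (hP : IsIdempotentElem P) (hQ : IsIdempotentElem Q) : IsIdempotentElem (blockSum P Q) :=
  isIdempotentElem_reindex (isIdempotentElem_fromBlocks hP hQ) _

theorem Equiv₀.blockSum {m n m' n' : ℕ} {A : Type*} [NonUnitalRing A]
    {P : Matrix (Fin m) (Fin m) A} {Q : Matrix (Fin n) (Fin n) A}
    {P' : Matrix (Fin m') (Fin m') A} {Q' : Matrix (Fin n') (Fin n') A}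
    (hP : IsIdempotentElem P) (hQ : IsIdempotentElem Q)
    (hP' : IsIdempotentElem P') (hQ' : IsIdempotentElem Q')
    (h : Equiv₀ P P') (h' : Equiv₀ Q Q') : Equiv₀ (OpK.blockSum P Q) (OpK.blockSum P' Q') := by
  have i := isIdempotentElem_fromBlocks hP hQ
  have i' := isIdempotentElem_fromBlocks hP' hQ'
  exact ((Equiv₀.reindex i _).symm.trans (isIdempotentElem_blockSum hP hQ) i'
    (h.fromBlocks h')).trans (isIdempotentElem_blockSum hP hQ)
    (isIdempotentElem_blockSum hP' hQ') (Equiv₀.reindex i' _)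

/-- The idempotent matrices of all finite sizes over `A`. The empty matrix is admitted as well;
it is equivalent to every zero matrix (`Idem.zero_equiv` below), so it does not affect the
classes. -/
def Idem (A : Type v) [NonUnitalRing A] : Type v :=
  Σ n : ℕ, {P : Matrix (Fin n) (Fin n) A // IsIdempotentElem P}

instance Idem.setoid (A : Type v) [NonUnitalRing A] : Setoid (Idem A) where
  r P Q := Equiv₀ P.2.1 Q.2.1
  iseqv :=
    { refl := fun P => Equiv₀.refl P.2.2
      symm := fun h => h.symm
      trans := fun {P _ S} h h' => h.trans P.2.2 S.2.2 h' }

/-- `V(A)`, the set of equivalence classes of idempotent matrices over `A`. -/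
def V (A : Type v) [NonUnitalRing A] : Type v := Quotient (Idem.setoid A)

/-- The class `[P]_V` of an idempotent matrix `P`. -/
def V.mk {A : Type v} [NonUnitalRing A] {n : ℕ} (P : Matrix (Fin n) (Fin n) A)
    (hP : IsIdempotentElem P) : V A := Quotient.mk (Idem.setoid A) ⟨n, P, hP⟩

theorem V.sound {A : Type v} [NonUnitalRing A] {m n : ℕ} {P : Matrix (Fin m) (Fin m) A}
    {Q : Matrix (Fin n) (Fin n) A} (hP : IsIdempotentElem P) (hQ : IsIdempotentElem Q)
    (h : Equiv₀ P Q) : V.mk P hP = V.mk Q hQ := Quotient.sound h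

/-- All square zero matrices, including the empty one, are equivalent. -/
theorem Idem.zero_equiv {A : Type v} [NonUnitalRing A] (m n : ℕ) :
    Equiv₀ (0 : Matrix (Fin m) (Fin m) A) (0 : Matrix (Fin n) (Fin n) A) :=
  ⟨0, 0, by simp, by simp⟩

theorem Idem.isIdempotentElem_zero {A : Type v} [NonUnitalRing A] (n : ℕ) :
    IsIdempotentElem (0 : Matrix (Fin n) (Fin n) A) := by simp [IsIdempotentElem]

/-- Addition on `V(A)`: `[P]_V + [Q]_V = [P ⊕ Q]_V`. -/
instance V.instAdd (A : Type v) [NonUnitalRing A] : Add (V A) where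
  add := Quotient.map₂
    (fun P Q => ⟨P.1 + Q.1, blockSum P.2.1 Q.2.1, isIdempotentElem_blockSum P.2.2 Q.2.2⟩)
    (fun P P' h Q Q' h' => Equiv₀.blockSum P.2.2 Q.2.2 P'.2.2 Q'.2.2 h h')

instance V.instZero (A : Type v) [NonUnitalRing A] : Zero (V A) where
  zero := V.mk (n := 0) 0 (Idem.isIdempotentElem_zero 0)

theorem V.mk_add_mk {A : Type v} [NonUnitalRing A] {m n : ℕ} {P : Matrix (Fin m) (Fin m) A}
    {Q : Matrix (Fin n) (Fin n) A} (hP : IsIdempotentElem P) (hQ : IsIdempotentElem Q) :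
    V.mk P hP + V.mk Q hQ = V.mk (blockSum P Q) (isIdempotentElem_blockSum hP hQ) := rfl

theorem V.mk_zero {A : Type v} [NonUnitalRing A] (n : ℕ) :
    V.mk (0 : Matrix (Fin n) (Fin n) A) (Idem.isIdempotentElem_zero n) = 0 :=
  V.sound _ _ (Idem.zero_equiv n 0)

theorem Equiv₀.fromBlocks_comm {m n A : Type*} [Fintype m] [Fintype n] [NonUnitalRing A]
    {P : Matrix m m A} {Q : Matrix n n A} (hP : IsIdempotentElem P) (hQ : IsIdempotentElem Q) :
    Equiv₀ (Matrix.fromBlocks P 0 0 Q) (Matrix.fromBlocks Q 0 0 P) :=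
  ⟨Matrix.fromBlocks 0 P Q 0, Matrix.fromBlocks 0 Q P 0,
    by simp [Matrix.fromBlocks_multiply, hP.eq, hQ.eq],
    by simp [Matrix.fromBlocks_multiply, hP.eq, hQ.eq]⟩

theorem Equiv₀.fromBlocks_zero {m n A : Type*} [Fintype m] [Fintype n] [NonUnitalRing A]
    {P : Matrix m m A} (hP : IsIdempotentElem P) :
    Equiv₀ (Matrix.fromBlocks P 0 0 (0 : Matrix n n A)) P := by
  refine ⟨Matrix.fromRows P 0, Matrix.fromCols P 0, ?_, ?_⟩
  · ext i j
    have h := fun i j => congrFun (congrFun hP.eq i) j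
    simp only [Matrix.mul_apply] at h
    rcases i with i | i <;> rcases j with j | j <;> simp [Matrix.mul_apply, h]
  · ext i j
    have h := fun i j => congrFun (congrFun hP.eq i) j
    simp only [Matrix.mul_apply] at h
    simp [Matrix.mul_apply, h]

/-- `V(A)` is a commutative monoid. -/
instance V.instAddCommMonoid (A : Type v) [NonUnitalRing A] : AddCommMonoid (V A) where
  add_assoc := by
    rintro ⟨m, P, hP⟩ ⟨n, Q, hQ⟩ ⟨k, S, hS⟩
    change V.mk P hP + V.mk Q hQ + V.mk S hS = V.mk P hP + (V.mk Q hQ + V.mk S hS)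
    simp only [V.mk_add_mk]
    refine V.sound _ _ ?_
    have iPQ := isIdempotentElem_blockSum hP hQ
    have iQS := isIdempotentElem_blockSum hQ hS
    have b₁ := isIdempotentElem_fromBlocks hP hQ
    have b₂ := isIdempotentElem_fromBlocks hQ hS
    have c₁ := isIdempotentElem_fromBlocks iPQ hS
    have c₂ := isIdempotentElem_fromBlocks hP iQS
    have d₁ := isIdempotentElem_fromBlocks b₁ hS
    have d₂ := isIdempotentElem_fromBlocks hP b₂
    have f₁ := isIdempotentElem_blockSum iPQ hS
    have f₂ := isIdempotentElem_blockSum hP iQS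
    have s₁ : Equiv₀ (blockSum (blockSum P Q) S)
        (Matrix.fromBlocks (Matrix.fromBlocks P 0 0 Q) 0 0 S) :=
      (Equiv₀.reindex c₁ _).symm.trans f₁ d₁
        (((Equiv₀.reindex b₁ _).symm).fromBlocks (Equiv₀.refl hS))
    have s₂ : Equiv₀ (Matrix.fromBlocks P 0 0 (Matrix.fromBlocks Q 0 0 S))
        (blockSum P (blockSum Q S)) :=
      ((Equiv₀.refl hP).fromBlocks (Equiv₀.reindex b₂ _)).trans d₂ f₂ (Equiv₀.reindex c₂ _)
    have s₃ : Equiv₀ (Matrix.fromBlocks (Matrix.fromBlocks P 0 0 Q) 0 0 S)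
        (Matrix.fromBlocks P 0 0 (Matrix.fromBlocks Q 0 0 S)) := by
      have h := Equiv₀.reindex d₁ (Equiv.sumAssoc (Fin m) (Fin n) (Fin k))
      convert h using 1
      ext (i | i | i) (j | j | j) <;> rfl
    exact (s₁.trans f₁ d₂ s₃).trans f₁ f₂ s₂
  zero_add := by
    rintro ⟨m, P, hP⟩
    have z := Idem.isIdempotentElem_zero (A := A) 0
    refine V.sound (isIdempotentElem_blockSum z hP) hP ?_
    have i := isIdempotentElem_fromBlocks z hP
    exact ((Equiv₀.reindex i _).symm.trans (isIdempotentElem_blockSum z hP)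
      (isIdempotentElem_fromBlocks hP z) (Equiv₀.fromBlocks_comm z hP)).trans
      (isIdempotentElem_blockSum z hP) hP (Equiv₀.fromBlocks_zero hP)
  add_zero := by
    rintro ⟨m, P, hP⟩
    have z := Idem.isIdempotentElem_zero (A := A) 0
    refine V.sound (isIdempotentElem_blockSum hP z) hP ?_
    have i := isIdempotentElem_fromBlocks hP z
    exact (Equiv₀.reindex i _).symm.trans (isIdempotentElem_blockSum hP z) hP
      (Equiv₀.fromBlocks_zero hP)
  add_comm := by
    rintro ⟨m, P, hP⟩ ⟨n, Q, hQ⟩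
    refine V.sound (isIdempotentElem_blockSum hP hQ) (isIdempotentElem_blockSum hQ hP) ?_
    have i := isIdempotentElem_fromBlocks hP hQ
    have i' := isIdempotentElem_fromBlocks hQ hP
    exact ((Equiv₀.reindex i _).symm.trans (isIdempotentElem_blockSum hP hQ) i'
      (Equiv₀.fromBlocks_comm hP hQ)).trans (isIdempotentElem_blockSum hP hQ)
      (isIdempotentElem_blockSum hQ hP) (Equiv₀.reindex i' _)
  nsmul := nsmulRec

end Idempotents

/-! ### The group `K₀` -/

/-- `K₀` of a unital ring: the Grothendieck group of `V(A)`. -/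
abbrev K0Unital (A : Type v) [Ring A] : Type v := Algebra.GrothendieckAddGroup (V A)

/-- The class `[P]₀` of an idempotent matrix in `K₀` of a unital ring. -/
noncomputable def K0Unital.mk {A : Type v} [Ring A] {n : ℕ} (P : Matrix (Fin n) (Fin n) A)
    (hP : IsIdempotentElem P) : K0Unital A := Algebra.GrothendieckAddGroup.of (V.mk P hP)

section NonUnital

/-- The scalar map `s : A^♯ → A^♯`, `s (ζ + a) = ζ`, where `A^♯` is the algebra `A` with an
identity adjoined. -/
def scalarMap (A : Type v) [NonUnitalRing A] [Module ℂ A] [IsScalarTower ℂ A A]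
    [SMulCommClass ℂ A A] : Unitization ℂ A →+* Unitization ℂ A :=
  (algebraMap ℂ (Unitization ℂ A)).comp (Unitization.fstHom ℂ A).toRingHom

theorem isIdempotentElem_mapMatrix {A B : Type*} [Ring A] [Ring B] (f : A →+* B) {n : ℕ}
    {P : Matrix (Fin n) (Fin n) A} (hP : IsIdempotentElem P) :
    IsIdempotentElem (f.mapMatrix P) := hP.map f.mapMatrix

theorem mapMatrix_blockSum {A B : Type*} [Ring A] [Ring B] (f : A →+* B) {m n : ℕ}
    (P : Matrix (Fin m) (Fin m) A) (Q : Matrix (Fin n) (Fin n) A) :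
    f.mapMatrix (blockSum P Q) = blockSum (f.mapMatrix P) (f.mapMatrix Q) := by
  ext i j
  obtain ⟨i, rfl⟩ := finSumFinEquiv.surjective i
  obtain ⟨j, rfl⟩ := finSumFinEquiv.surjective j
  rcases i with i | i <;> rcases j with j | j <;> simp [blockSum]

theorem K0Unital.mk_add_mk {A : Type v} [Ring A] {m n : ℕ} {P : Matrix (Fin m) (Fin m) A}
    {Q : Matrix (Fin n) (Fin n) A} (hP : IsIdempotentElem P) (hQ : IsIdempotentElem Q) :
    K0Unital.mk P hP + K0Unital.mk Q hQ
      = K0Unital.mk (blockSum P Q) (isIdempotentElem_blockSum hP hQ) := by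
  simp only [K0Unital.mk, ← map_add, V.mk_add_mk]

theorem K0Unital.mk_zero {A : Type v} [Ring A] (n : ℕ) :
    K0Unital.mk (0 : Matrix (Fin n) (Fin n) A) (Idem.isIdempotentElem_zero n) = 0 := by
  simp only [K0Unital.mk, V.mk_zero, map_zero]

theorem K0Unital.mk_add_mk_one_sub {A : Type v} [Ring A] {n : ℕ}
    {P : Matrix (Fin n) (Fin n) A} (hP : IsIdempotentElem P) :
    K0Unital.mk P hP + K0Unital.mk (1 - P) hP.one_sub
      = K0Unital.mk (1 : Matrix (Fin n) (Fin n) A) IsIdempotentElem.one := by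
  rw [K0Unital.mk_add_mk]
  simp only [K0Unital.mk]
  congr 1
  refine V.sound _ _ ?_
  have i := isIdempotentElem_fromBlocks hP hP.one_sub
  refine (Equiv₀.reindex i _).symm.trans (isIdempotentElem_blockSum hP hP.one_sub)
    IsIdempotentElem.one ⟨Matrix.fromRows P (1 - P), Matrix.fromCols P (1 - P), ?_, ?_⟩
  · rw [Matrix.fromRows_mul_fromCols, hP.eq, hP.one_sub.eq]
    congr 1
    · rw [mul_sub, mul_one, hP.eq, sub_self]
    · rw [sub_mul, one_mul, hP.eq, sub_self]
  · rw [Matrix.fromCols_mul_fromRows, hP.eq, hP.one_sub.eq]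
    simp

/-- `K₀` of a non-unital complex algebra `A`, as the subgroup
`{[P]₀ - [s_n(P)]₀ : n ∈ ℕ, P an idempotent in M_n(A^♯)}` of `K₀(A^♯)`. -/
noncomputable def K0Subgroup (A : Type v) [NonUnitalRing A] [Module ℂ A]
    [IsScalarTower ℂ A A] [SMulCommClass ℂ A A] : AddSubgroup (K0Unital (Unitization ℂ A)) where
  carrier := {g | ∃ (n : ℕ) (P : Matrix (Fin n) (Fin n) (Unitization ℂ A))
    (hP : IsIdempotentElem P), g = K0Unital.mk P hP -
      K0Unital.mk ((scalarMap A).mapMatrix P) (isIdempotentElem_mapMatrix (scalarMap A) hP)}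
  zero_mem' := by
    refine ⟨0, 0, Idem.isIdempotentElem_zero 0, ?_⟩
    simp only [map_zero, sub_self]
  add_mem' := by
    rintro _ _ ⟨m, P, hP, rfl⟩ ⟨n, Q, hQ, rfl⟩
    refine ⟨m + n, blockSum P Q, isIdempotentElem_blockSum hP hQ, ?_⟩
    simp only [mapMatrix_blockSum]
    rw [← K0Unital.mk_add_mk hP hQ, ← K0Unital.mk_add_mk
      (isIdempotentElem_mapMatrix (scalarMap A) hP) (isIdempotentElem_mapMatrix (scalarMap A) hQ)]
    abel
  neg_mem' := by
    rintro _ ⟨n, P, hP, rfl⟩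
    refine ⟨n, 1 - P, hP.one_sub, ?_⟩
    have h₁ := K0Unital.mk_add_mk_one_sub hP
    have h₂ := K0Unital.mk_add_mk_one_sub (isIdempotentElem_mapMatrix (scalarMap A) hP)
    simp only [map_sub, map_one]
    rw [neg_sub, sub_eq_sub_iff_add_eq_add]
    exact h₂.trans (h₁.symm.trans (add_comm _ _))

/-- `K₀` of a non-unital complex algebra. -/
abbrev K0 (A : Type v) [NonUnitalRing A] [Module ℂ A] [IsScalarTower ℂ A A]
    [SMulCommClass ℂ A A] : Type v := K0Subgroup A

theorem isIdempotentElem_map_nonUnital {A B : Type*} [NonUnitalRing A] [Module ℂ A]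
    [NonUnitalRing B] [Module ℂ B] (f : A →ₙₐ[ℂ] B) {n : ℕ}
    {P : Matrix (Fin n) (Fin n) A} (hP : IsIdempotentElem P) : IsIdempotentElem (P.map f) := by
  have h : (P * P).map f = P.map f * P.map f := by
    ext i j
    simp [Matrix.mul_apply]
  rw [IsIdempotentElem, ← h, hP.eq]

/-- The class `[P]₀ ∈ K₀(A)` of an idempotent matrix `P` over the non-unital algebra `A`
itself, namely its class as a matrix over `A^♯` (note that `s_n(P) = 0`). -/
noncomputable def K0.mk {A : Type v} [NonUnitalRing A] [Module ℂ A] [IsScalarTower ℂ A A]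
    [SMulCommClass ℂ A A] {n : ℕ} (P : Matrix (Fin n) (Fin n) A) (hP : IsIdempotentElem P) :
    K0 A :=
  ⟨K0Unital.mk (P.map (Unitization.inrNonUnitalAlgHom ℂ A))
      (isIdempotentElem_map_nonUnital (Unitization.inrNonUnitalAlgHom ℂ A) hP), by
    refine ⟨n, P.map (Unitization.inrNonUnitalAlgHom ℂ A),
      isIdempotentElem_map_nonUnital (Unitization.inrNonUnitalAlgHom ℂ A) hP, ?_⟩
    have h : (scalarMap A).mapMatrix (P.map (Unitization.inrNonUnitalAlgHom ℂ A)) = 0 := by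
      ext i j <;> simp [scalarMap]
    simp only [h, K0Unital.mk_zero, sub_zero]⟩

end NonUnital

/-- The class `[Q]₀ ∈ K₀(J(X))` of an idempotent matrix `Q` of finite-rank operators on `X`,
where `J` is a non-zero ideal of operators. -/
noncomputable def OperatorIdeal.NonZero.k0Class {J : OperatorIdeal.{u}} (hJ : J.NonZero)
    {X : Type u} [NormedAddCommGroup X] [NormedSpace ℂ X] [InfDimBanach X] {n : ℕ}
    (Q : Matrix (Fin n) (Fin n) (finiteRank X)) (hQ : IsIdempotentElem Q) : K0 (J.alg X) :=
  K0.mk (Q.map (NonUnitalSubalgebra.inclusion (hJ.finiteRank_le X)))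
    (isIdempotentElem_map_nonUnital (NonUnitalSubalgebra.inclusion (hJ.finiteRank_le X)) hQ)

end OpK

/-!
The argument rests on one fact from Fredholm theory: if `K` is strictly singular on a Banach
space, then `1 + K` is the sum of an invertible and a finite-rank operator
(`IsStrictlySingular.isWeyl_one_add`). To see this, note first that `1 + K` is bounded below on
a closed subspace of finite codimension; otherwise there is an infinite-dimensional subspace on
which `1 + K` has norm at most `1 / 2`, and there `K` is bounded below. An operator which is
bounded below on a closed subspace of finite codimension, and which is a limit of sums of
invertible and finite-rank operators, is itself such a sum
(`BoundedBelowOn.isWeyl_of_mem_closure`). Hence the set of real `t` for which `1 + t • K` is such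
a sum is closed; it is also open and contains `0`, so that it contains `1`.

Let `A = J(X)`. It is a left ideal of the algebra of all operators, so that `A^♯` is
inverse-closed there.

* Injectivity. A matrix `b` over `A^♯` with a left inverse is, after multiplication by an
  invertible scalar matrix, an injective operator of the form `1 + K`, and therefore invertible.
  So `A^♯` is stably finite (`IsSingularIdeal.isStablyFiniteRing_unitization`), and over
  a stably finite ring no non-zero idempotent matrix has a class of finite order
  (`K0Unital.eq_zero_of_nsmul_mk_eq_zero`).
* Surjectivity. Let `P` be an idempotent matrix over `A^♯` with scalar part `E`. Then
  `Z = P E + (1 - P) (1 - E)` is of the form `1 + K` and satisfies `P Z = Z E`. Removing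
  a finite-rank operator from `Z` makes it invertible, and conjugation by the result turns `P` into
  a finite-rank perturbation of `E`
  (`IsSingularIdeal.exists_equiv₀_finiteRank_perturbation`). The perturbation lives under
  a finite-rank diagonal idempotent `G` that commutes with `E`, so the difference of the classes is
  that of two finite-rank idempotents. The class of a finite-rank idempotent is its rank times the
  class of any rank one idempotent (`IsSingularIdeal.mk_eq_finrank_nsmul`).
-/

namespace OpK

/-! ### Operators that are bounded below on a subspace -/

section BoundedBelow

variable {Y : Type u} [NormedAddCommGroup Y] [NormedSpace ℂ Y]

/-- `T` is bounded below on the subspace `M`. -/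
def BoundedBelowOn (T : Y →L[ℂ] Y) (M : Submodule ℂ Y) : Prop :=
  ∃ c : ℝ, 0 < c ∧ ∀ x ∈ M, c * ‖x‖ ≤ ‖T x‖

theorem exists_clm_eq_one_of_notMem {M : Submodule ℂ Y} (hM : IsClosed (M : Set Y)) {y : Y}
    (hy : y ∉ M) : ∃ f : Y →L[ℂ] ℂ, f y = 1 ∧ ∀ x ∈ M, f x = 0 := by
  have : IsClosed (M : Set Y) := hM
  have hy' : (Submodule.Quotient.mk y : Y ⧸ M) ≠ 0 := by
    rwa [Ne, Submodule.Quotient.mk_eq_zero]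
  obtain ⟨g, hg⟩ := SeparatingDual.exists_eq_one (R := ℂ) hy'
  refine ⟨g.comp M.mkQL, hg, fun x hx => ?_⟩
  have : (Submodule.Quotient.mk x : Y ⧸ M) = 0 := (Submodule.Quotient.mk_eq_zero M).2 hx
  change g (Submodule.Quotient.mk x) = 0
  rw [this, map_zero]

theorem BoundedBelowOn.antilipschitz {T : Y →L[ℂ] Y} {M : Submodule ℂ Y}
    (h : BoundedBelowOn T M) : ∃ K, AntilipschitzWith K (T.comp M.subtypeL) := by
  obtain ⟨c, hc, h⟩ := h
  refine ⟨⟨c⁻¹, by positivity⟩, ContinuousLinearMap.antilipschitz_of_bound _ fun x => ?_⟩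
  have := h x x.2
  change ‖(x : Y)‖ ≤ c⁻¹ * ‖T x‖
  rw [inv_mul_eq_div, le_div_iff₀ hc]
  linarith

theorem BoundedBelowOn.isClosed_map [CompleteSpace Y] {T : Y →L[ℂ] Y} {M : Submodule ℂ Y}
    (hM : IsClosed (M : Set Y)) (h : BoundedBelowOn T M) :
    IsClosed (M.map (T : Y →ₗ[ℂ] Y) : Set Y) := by
  have : CompleteSpace M := hM.completeSpace_coe
  obtain ⟨K, hK⟩ := h.antilipschitz
  have h := hK.isClosed_range (T.comp M.subtypeL).uniformContinuous
  convert h using 1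
  ext y
  simp

/-- One step in enlarging the subspace on which an operator is bounded below: a direction
`d ∉ M` is sent to some `y ∉ T M` by a rank one perturbation that vanishes on `M`. -/
theorem BoundedBelowOn.exists_sup_span [CompleteSpace Y] {T : Y →L[ℂ] Y} {M : Submodule ℂ Y}
    (hM : IsClosed (M : Set Y)) (h : BoundedBelowOn T M) {d y : Y} (hd : d ∉ M)
    (hy : y ∉ M.map (T : Y →ₗ[ℂ] Y)) :
    ∃ F ∈ finiteRank Y, BoundedBelowOn (T + F) (M ⊔ Submodule.span ℂ {d}) := by
  obtain ⟨f, hfd, hfM⟩ := exists_clm_eq_one_of_notMem hM hd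
  obtain ⟨g, hgy, hgM⟩ := exists_clm_eq_one_of_notMem (h.isClosed_map hM) hy
  obtain ⟨c, hc, h⟩ := h
  refine ⟨f.smulRight (y - T d), ?_, ?_⟩
  · refine Submodule.finiteDimensional_of_le (S₂ := Submodule.span ℂ {y - T d}) ?_
    rintro _ ⟨x, rfl⟩
    exact Submodule.smul_mem _ _ (Submodule.mem_span_singleton_self _)
  -- On `m + a • d` the new operator is `T m + a • y`; the functional `g` recovers `a`.
  set C : ℝ := c⁻¹ * (1 + ‖g‖ * ‖y‖) + ‖g‖ * ‖d‖ with hC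
  have hC0 : 0 < C := by positivity
  refine ⟨C⁻¹, by positivity, fun x hx => ?_⟩
  obtain ⟨m, hm, e, he, rfl⟩ := Submodule.mem_sup.1 hx
  obtain ⟨a, rfl⟩ := Submodule.mem_span_singleton.1 he
  have hval : (T + f.smulRight (y - T d)) (m + a • d) = T m + a • y := by
    simp [hfM m hm, hfd, smul_sub]
  rw [hval]
  have ha : ‖a‖ ≤ ‖g‖ * ‖T m + a • y‖ := by
    have := g.le_opNorm (T m + a • y)
    rwa [map_add, show g (T m) = 0 from hgM _ ⟨m, hm, rfl⟩, map_smul, hgy,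
      zero_add, smul_eq_mul, mul_one] at this
  set t := ‖T m + a • y‖
  have ht : 0 ≤ t := norm_nonneg _
  have hTm : ‖T m‖ ≤ t + ‖a‖ * ‖y‖ := by
    have := norm_sub_le (T m + a • y) (a • y)
    rwa [add_sub_cancel_right, norm_smul] at this
  have hm' : ‖m‖ ≤ c⁻¹ * (t + ‖a‖ * ‖y‖) := by
    rw [inv_mul_eq_div, le_div_iff₀ hc]
    linarith [h m hm]
  rw [inv_mul_eq_div, div_le_iff₀ hC0]
  calc ‖m + a • d‖ ≤ ‖m‖ + ‖a‖ * ‖d‖ := by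
        rw [← norm_smul]; exact norm_add_le _ _
    _ ≤ c⁻¹ * (t + (‖g‖ * t) * ‖y‖) + (‖g‖ * t) * ‖d‖ := by
        refine add_le_add (hm'.trans ?_) ?_
        · gcongr
        · gcongr
    _ = t * C := by rw [hC]; ring

/-- An operator that is bounded below on a closed subspace of finite codimension becomes, after a
finite-rank perturbation, bounded below everywhere (non-positive index), or else an isomorphism
from a proper closed subspace onto the whole space (positive index). -/
theorem BoundedBelowOn.exists_finiteRank_add [CompleteSpace Y] (s : Finset Y) :
    ∀ (T : Y →L[ℂ] Y) (M : Submodule ℂ Y), IsClosed (M : Set Y) → BoundedBelowOn T M →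
      M ⊔ Submodule.span ℂ (s : Set Y) = ⊤ →
      ∃ F ∈ finiteRank Y, BoundedBelowOn (T + F) ⊤ ∨
        ∃ N : Submodule ℂ Y, IsClosed (N : Set Y) ∧ N ≠ ⊤ ∧ BoundedBelowOn (T + F) N ∧
          N.map ((T + F : Y →L[ℂ] Y) : Y →ₗ[ℂ] Y) = ⊤ := by
  classical
  induction s using Finset.induction_on with
  | empty =>
    intro T M _ h hs
    refine ⟨0, zero_mem _, Or.inl ?_⟩
    simp only [Finset.coe_empty, Submodule.span_empty, sup_bot_eq] at hs
    rwa [add_zero, ← hs]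
  | insert d s _ ih =>
    intro T M hM h hs
    rw [Finset.coe_insert, Submodule.span_insert, ← sup_assoc] at hs
    by_cases hd : d ∈ M
    · have : M ⊔ Submodule.span ℂ {d} = M := by
        rw [sup_eq_left, Submodule.span_le]; simpa using hd
      rw [this] at hs
      exact ih T M hM h hs
    by_cases hT : M.map (T : Y →ₗ[ℂ] Y) = ⊤
    · refine ⟨0, zero_mem _, Or.inr ⟨M, hM, ?_, ?_, ?_⟩⟩
      · rintro rfl
        exact hd trivial
      · rwa [add_zero]
      · rwa [add_zero]
    obtain ⟨y, -, hy⟩ := SetLike.exists_of_lt (lt_top_iff_ne_top.2 hT)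
    obtain ⟨F, hF, hTF⟩ := h.exists_sup_span hM hd hy
    obtain ⟨F', hF', hor⟩ :=
      ih (T + F) _ (Submodule.isClosed_sup_finiteDimensional _ _ hM) hTF hs
    rw [add_assoc] at hor
    exact ⟨F + F', add_mem hF hF', hor⟩

end BoundedBelow

/-! ### Operators that are finite-rank perturbations of invertible operators -/

section Weyl

variable {Y : Type u} [NormedAddCommGroup Y] [NormedSpace ℂ Y]

/-- `T` is the sum of an invertible and a finite-rank operator. On a Banach space these are
the Fredholm operators of index zero. -/
def IsWeyl (T : Y →L[ℂ] Y) : Prop :=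
  ∃ W F : Y →L[ℂ] Y, IsUnit W ∧ F ∈ finiteRank Y ∧ T = W + F

theorem IsWeyl.add_finiteRank {T F : Y →L[ℂ] Y} (hT : IsWeyl T) (hF : F ∈ finiteRank Y) :
    IsWeyl (T + F) := by
  obtain ⟨W, G, hW, hG, rfl⟩ := hT
  exact ⟨W, G + F, hW, add_mem hG hF, add_assoc _ _ _⟩

theorem isWeyl_of_isUnit {T : Y →L[ℂ] Y} (hT : IsUnit T) : IsWeyl T :=
  ⟨T, 0, hT, zero_mem _, (add_zero T).symm⟩

theorem mul_mem_finiteRank_of_right (W : Y →L[ℂ] Y) {F : Y →L[ℂ] Y} (hF : F ∈ finiteRank Y) :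
    W * F ∈ finiteRank Y := by
  have : FiniteDimensional ℂ (LinearMap.range (F : Y →ₗ[ℂ] Y)) := hF
  refine Submodule.finiteDimensional_of_le
    (S₂ := (LinearMap.range (F : Y →ₗ[ℂ] Y)).map (W : Y →ₗ[ℂ] Y)) ?_
  rintro _ ⟨x, rfl⟩
  exact ⟨F x, ⟨x, rfl⟩, rfl⟩

/-- For a finite-rank `F` the operator `1 + F` is governed by its restriction to the range of `F`,
which is finite-dimensional. -/
theorem one_add_injective_iff_surjective {F : Y →L[ℂ] Y} (hF : F ∈ finiteRank Y) :
    Function.Injective (1 + F : Y →L[ℂ] Y) ↔ Function.Surjective (1 + F : Y →L[ℂ] Y) := by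
  set R := LinearMap.range (F : Y →ₗ[ℂ] Y) with hR
  have : FiniteDimensional ℂ R := hF
  have hFR : ∀ x, F x ∈ R := fun x => ⟨x, rfl⟩
  let G : R →ₗ[ℂ] R := ((1 + F : Y →L[ℂ] Y) : Y →ₗ[ℂ] Y).restrict
    (fun x hx => add_mem hx (hFR x))
  have hG : ∀ x : R, (G x : Y) = x + F x := fun x => rfl
  have h := LinearMap.injective_iff_surjective (f := G)
  constructor
  · intro hi y
    have hGi : Function.Injective G := fun a b hab => Subtype.ext (hi (congrArg Subtype.val hab))
    obtain ⟨r, hr⟩ := h.1 hGi ⟨F y, hFR y⟩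
    have hr' : (r : Y) + F r = F y := congrArg Subtype.val hr
    refine ⟨y - r, ?_⟩
    change (y - r) + F (y - r) = y
    rw [map_sub, ← hr']
    abel
  · intro hs
    have hGs : Function.Surjective G := by
      intro r
      obtain ⟨x, hx⟩ := hs r
      have hx' : x + F x = r := hx
      have hxR : x ∈ R := by
        rw [eq_sub_of_add_eq hx']
        exact sub_mem r.2 (hFR x)
      exact ⟨⟨x, hxR⟩, Subtype.ext hx'⟩
    refine (injective_iff_map_eq_zero (1 + F : Y →L[ℂ] Y)).2 fun x hx => ?_
    have hx' : x + F x = 0 := hx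
    have hxR : x ∈ R := by
      rw [eq_neg_of_add_eq_zero_left hx']
      exact neg_mem (hFR x)
    have := h.2 hGs (a₁ := ⟨x, hxR⟩) (a₂ := 0) (Subtype.ext (by rw [hG]; simpa using hx'))
    exact congrArg Subtype.val this

theorem IsWeyl.injective_iff_surjective {T : Y →L[ℂ] Y} (hT : IsWeyl T) :
    Function.Injective T ↔ Function.Surjective T := by
  obtain ⟨_, F, ⟨W, rfl⟩, hF, rfl⟩ := hT
  have e : (W : Y →L[ℂ] Y) + F = W * (1 + ((W⁻¹ : (Y →L[ℂ] Y)ˣ) : Y →L[ℂ] Y) * F) := by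
    rw [mul_add, mul_one, ← mul_assoc, Units.mul_inv, one_mul]
  have hW : Function.Bijective (W : Y →L[ℂ] Y) := by
    refine Function.bijective_iff_has_inverse.2 ⟨((W⁻¹ : (Y →L[ℂ] Y)ˣ) : Y →L[ℂ] Y), ?_, ?_⟩
    · intro x
      exact DFunLike.congr_fun W.inv_mul x
    · intro x
      exact DFunLike.congr_fun W.mul_inv x
  rw [e]
  have h := one_add_injective_iff_surjective
    (mul_mem_finiteRank_of_right ((W⁻¹ : (Y →L[ℂ] Y)ˣ) : Y →L[ℂ] Y) hF)
  rw [ContinuousLinearMap.mul_def, ContinuousLinearMap.coe_comp, hW.1.of_comp_iff,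
    Function.Surjective.of_comp_iff' hW, h]

theorem IsWeyl.isUnit_of_injective [CompleteSpace Y] {T : Y →L[ℂ] Y} (hT : IsWeyl T)
    (hi : Function.Injective T) : IsUnit T :=
  ContinuousLinearMap.isUnit_iff_bijective.2 ⟨hi, hT.injective_iff_surjective.1 hi⟩

theorem isOpen_isWeyl [CompleteSpace Y] : IsOpen {T : Y →L[ℂ] Y | IsWeyl T} := by
  rw [isOpen_iff_mem_nhds]
  rintro _ ⟨W, F, hW, hF, rfl⟩
  have h : Filter.Tendsto (fun T : Y →L[ℂ] Y => T - F) (nhds (W + F)) (nhds W) := by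
    have : Continuous fun T : Y →L[ℂ] Y => T - F := by fun_prop
    simpa using this.tendsto (W + F)
  filter_upwards [h (Units.isOpen.mem_nhds hW)] with T hT
  exact ⟨T - F, F, hT, hF, by abel⟩

/-- A limit of finite-rank perturbations of invertible operators that is bounded below is
invertible. -/
theorem BoundedBelowOn.isUnit_of_mem_closure [CompleteSpace Y] {T : Y →L[ℂ] Y}
    (h : BoundedBelowOn T ⊤) (hT : T ∈ closure {T : Y →L[ℂ] Y | IsWeyl T}) : IsUnit T := by
  have hcl := h.isClosed_map isClosed_univ
  obtain ⟨c, hc, hb⟩ := h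
  have hb : ∀ x, c * ‖x‖ ≤ ‖T x‖ := fun x => hb x trivial
  refine ContinuousLinearMap.isUnit_iff_bijective.2 ⟨?_, fun y => ?_⟩
  · refine (injective_iff_map_eq_zero T).2 fun x hx => norm_le_zero_iff.1 ?_
    have := hb x
    rw [hx, norm_zero] at this
    nlinarith [norm_nonneg x]
  suffices hy : y ∈ (Submodule.map (T : Y →ₗ[ℂ] Y) ⊤ : Submodule ℂ Y) by
    obtain ⟨x, -, hx⟩ := hy
    exact ⟨x, hx⟩
  rw [← SetLike.mem_coe, ← hcl.closure_eq, Metric.mem_closure_iff]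
  intro ε hε
  set δ := min (c / 2) (ε * (c / 2) / (‖y‖ + 1)) with hδ
  have hδ0 : 0 < δ := by positivity
  obtain ⟨S, hS, hST⟩ := Metric.mem_closure_iff.1 hT δ hδ0
  rw [dist_eq_norm] at hST
  have hSb : ∀ x, c / 2 * ‖x‖ ≤ ‖S x‖ := fun x => by
    have h1 := hb x
    have h2 := (T - S).le_opNorm x
    have h3 : ‖T x‖ ≤ ‖S x‖ + ‖(T - S) x‖ := by
      have := norm_add_le (S x) ((T - S) x)
      simpa using this
    have h4 : ‖T - S‖ * ‖x‖ ≤ c / 2 * ‖x‖ := by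
      gcongr
      exact hST.le.trans (min_le_left _ _)
    linarith
  have hSi : Function.Injective S := by
    refine (injective_iff_map_eq_zero S).2 fun x hx => norm_le_zero_iff.1 ?_
    have := hSb x
    rw [hx, norm_zero] at this
    nlinarith [norm_nonneg x]
  obtain ⟨x, rfl⟩ := (IsWeyl.injective_iff_surjective hS).1 hSi y
  refine ⟨T x, ⟨x, trivial, rfl⟩, ?_⟩
  rw [dist_eq_norm, norm_sub_rev]
  have hx : ‖x‖ ≤ ‖S x‖ / (c / 2) := by
    rw [le_div_iff₀ (by positivity)]
    linarith [hSb x]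
  calc ‖T x - S x‖ = ‖(T - S) x‖ := rfl
    _ ≤ ‖T - S‖ * ‖x‖ := (T - S).le_opNorm x
    _ ≤ (ε * (c / 2) / (‖S x‖ + 1)) * (‖S x‖ / (c / 2)) := by
        gcongr
        exact hST.le.trans (min_le_right _ _)
    _ = ε * (‖S x‖ / (‖S x‖ + 1)) := by field_simp
    _ < ε * 1 := by
        gcongr
        rw [div_lt_one (by positivity)]
        linarith
    _ = ε := mul_one ε

/-- A limit of finite-rank perturbations of invertible operators does not map a proper closed
subspace isomorphically onto the whole space. -/
theorem BoundedBelowOn.eq_top_of_mem_closure [CompleteSpace Y] {T : Y →L[ℂ] Y}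
    {M : Submodule ℂ Y} (hM : IsClosed (M : Set Y)) (h : BoundedBelowOn T M)
    (hTM : M.map (T : Y →ₗ[ℂ] Y) = ⊤) (hT : T ∈ closure {T : Y →L[ℂ] Y | IsWeyl T}) :
    M = ⊤ := by
  have : CompleteSpace M := hM.completeSpace_coe
  obtain ⟨K, hK⟩ := h.antilipschitz
  let e : M ≃L[ℂ] Y := ContinuousLinearEquiv.ofBijective (T.comp M.subtypeL)
    (LinearMap.ker_eq_bot.2 hK.injective) (by
      rw [← hTM]; ext y; simp)
  have he : (e : M →L[ℂ] Y) = T.comp M.subtypeL := by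
    ext x; simp [e]
  have hcont : Continuous fun S : Y →L[ℂ] Y => S.comp M.subtypeL := by fun_prop
  have hnear := hcont.continuousAt (he ▸ e.nhds)
  obtain ⟨S, ⟨e', he'⟩, hS⟩ := mem_closure_iff_nhds.1 hT _ hnear
  have he' : ∀ m : M, e' m = S m := fun m => DFunLike.congr_fun he' m
  have hSs : Function.Surjective S := fun y => ⟨e'.symm y, by rw [← he']; simp⟩
  have hSi := (IsWeyl.injective_iff_surjective hS).2 hSs
  refine eq_top_iff.2 fun x _ => ?_
  have : S x = S (e'.symm (S x) : M) := by rw [← he']; simp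
  rw [hSi this]
  exact Submodule.coe_mem _

/-- An operator that is bounded below on a closed subspace of finite codimension has index zero if
it is a limit of operators of index zero. -/
theorem BoundedBelowOn.isWeyl_of_mem_closure [CompleteSpace Y] {T : Y →L[ℂ] Y}
    {M : Submodule ℂ Y} (hM : IsClosed (M : Set Y)) (h : BoundedBelowOn T M) (hfin : M.CoFG)
    (hT : T ∈ closure {T : Y →L[ℂ] Y | IsWeyl T}) : IsWeyl T := by
  obtain ⟨N, hN⟩ := M.exists_isCompl
  obtain ⟨s, hs⟩ := hfin.fg_of_isCompl hN
  obtain ⟨F, hF, hor⟩ := BoundedBelowOn.exists_finiteRank_add s T M hM h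
    (by rw [hs]; exact hN.sup_eq_top)
  have hTF : T + F ∈ closure {T : Y →L[ℂ] Y | IsWeyl T} := by
    have hc : Continuous fun S : Y →L[ℂ] Y => S + F := by fun_prop
    exact map_mem_closure (f := fun S : Y →L[ℂ] Y => S + F) hc hT fun S hS =>
      IsWeyl.add_finiteRank hS hF
  rcases hor with hor | ⟨N, hNc, hNt, hNb, hNm⟩
  · have := (isWeyl_of_isUnit (hor.isUnit_of_mem_closure hTF)).add_finiteRank (neg_mem hF)
    rwa [add_neg_cancel_right] at this
  · exact absurd (hNb.eq_top_of_mem_closure hNc hNm hTF) hNt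

end Weyl

/-! ### The identity plus a strictly singular operator -/

section StrictlySingular

variable {Y : Type u} [NormedAddCommGroup Y] [NormedSpace ℂ Y]

/-- The coefficients with respect to a system that is triangular for norming functionals grow
at most like the powers of two. -/
theorem norm_coeff_le_of_triangular {x : ℕ → Y} {f : ℕ → Y →L[ℂ] ℂ} (hf : ∀ k, ‖f k‖ ≤ 1)
    (hx : ∀ k, ‖x k‖ = 1) (hfx : ∀ k, f k (x k) = 1) (htri : ∀ k j, k < j → f k (x j) = 0)
    (a : ℕ → ℂ) (N : ℕ) (k : ℕ) (hk : k < N) :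
    ‖a k‖ ≤ 2 ^ k * ‖∑ i ∈ Finset.range N, a i • x i‖ := by
  set v := ∑ i ∈ Finset.range N, a i • x i with hv
  induction k using Nat.strong_induction_on with
  | _ k ih =>
    have hsum : f k v = (∑ i ∈ Finset.range k, a i * f k (x i)) + a k := by
      rw [hv, map_sum, ← Finset.sum_range_add_sum_Ico _ (Nat.succ_le_of_lt hk),
        Finset.sum_range_succ]
      have : ∑ i ∈ Finset.Ico (k + 1) N, f k (a i • x i) = 0 :=
        Finset.sum_eq_zero fun i hi => by
          rw [map_smul, htri k i (Finset.mem_Ico.1 hi).1, smul_zero]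
      rw [this, add_zero]
      simp [hfx]
    have hle : ∀ y, ‖f k y‖ ≤ ‖y‖ := fun y =>
      (f k).le_of_opNorm_le (hf k) y |>.trans_eq (one_mul _)
    have hak : a k = f k v - ∑ i ∈ Finset.range k, a i * f k (x i) := by rw [hsum]; ring
    have hgeom : ∑ i ∈ Finset.range k, (2 : ℝ) ^ i = 2 ^ k - 1 := by
      rw [geom_sum_eq (by norm_num)]; norm_num
    calc ‖a k‖ ≤ ‖f k v‖ + ‖∑ i ∈ Finset.range k, a i * f k (x i)‖ := by
          rw [hak]; exact norm_sub_le _ _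
      _ ≤ ‖v‖ + ∑ i ∈ Finset.range k, 2 ^ i * ‖v‖ := by
          refine add_le_add (hle v) (norm_sum_le_of_le _ fun i hi => ?_)
          have hi := Finset.mem_range.1 hi
          have h1 := hle (x i)
          rw [hx] at h1
          rw [norm_mul]
          calc ‖a i‖ * ‖f k (x i)‖ ≤ ‖a i‖ * 1 := by gcongr
            _ ≤ 2 ^ i * ‖v‖ := by rw [mul_one]; exact ih i hi (hi.trans hk)
      _ = 2 ^ k * ‖v‖ := by
          rw [← Finset.sum_mul, hgeom]; ring

/-- If `T` is not bounded below on any closed subspace of finite codimension, then there is an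
infinite-dimensional subspace on which `T` has norm at most `1 / 2`. -/
theorem exists_infiniteDimensional_norm_le {T : Y →L[ℂ] Y}
    (hT : ∀ M : Submodule ℂ Y, IsClosed (M : Set Y) → M.CoFG → ¬ BoundedBelowOn T M) :
    ∃ V : Submodule ℂ Y, ¬ FiniteDimensional ℂ V ∧ ∀ v ∈ V, ‖T v‖ ≤ 2⁻¹ * ‖v‖ := by
  classical
  -- Triples of a unit vector, a norming functional and an index; each vector of the sequence is
  -- annihilated by the functionals of its predecessors, and has a larger index.
  obtain ⟨g, hP, hr⟩ := exists_seq_of_forall_finset_exists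
    (fun p : Y × (Y →L[ℂ] ℂ) × ℕ =>
      ‖p.1‖ = 1 ∧ ‖p.2.1‖ ≤ 1 ∧ p.2.1 p.1 = 1 ∧ ‖T p.1‖ ≤ 4⁻¹ ^ (p.2.2 + 1))
    (fun p q => p.2.1 q.1 = 0 ∧ p.2.2 < q.2.2) (by
      intro s _
      obtain ⟨n, hn⟩ : ∃ n, ∀ p ∈ s, p.2.2 < n :=
        ⟨s.sup (fun p => p.2.2) + 1, fun p hp =>
          Nat.lt_succ_of_le (Finset.le_sup (f := fun p => p.2.2) hp)⟩
      let Φ : Y →L[ℂ] (s → ℂ) := ContinuousLinearMap.pi fun p => p.1.2.1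
      have hker := hT (LinearMap.ker (Φ : Y →ₗ[ℂ] (s → ℂ))) Φ.isClosed_ker
        (Submodule.CoFG.ker _)
      simp only [BoundedBelowOn, not_exists, not_and, not_forall, not_le] at hker
      obtain ⟨x, hxM, hx⟩ := hker (4⁻¹ ^ (n + 1)) (by positivity)
      have hx0 : ‖x‖ ≠ 0 := by
        intro h
        rw [h, mul_zero] at hx
        exact absurd hx (not_lt.2 (norm_nonneg _))
      have hx1 : ‖((‖x‖ : ℂ)⁻¹ • x)‖ = 1 := by
        rw [norm_smul, norm_inv, Complex.norm_real, norm_norm, inv_mul_cancel₀ hx0]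
      obtain ⟨f, hf, hfx⟩ := exists_dual_vector'' ℂ ((‖x‖ : ℂ)⁻¹ • x)
      refine ⟨⟨(‖x‖ : ℂ)⁻¹ • x, f, n⟩, ⟨hx1, hf, by rw [hfx, hx1]; simp, ?_⟩,
        fun p hp => ⟨?_, hn p hp⟩⟩
      · change ‖T ((‖x‖ : ℂ)⁻¹ • x)‖ ≤ 4⁻¹ ^ (n + 1)
        rw [map_smul, norm_smul, norm_inv, Complex.norm_real, norm_norm, inv_mul_eq_div,
          div_le_iff₀ (by positivity)]
        exact hx.le
      · have : Φ x ⟨p, hp⟩ = 0 := congrFun hxM ⟨p, hp⟩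
        change p.2.1 ((‖x‖ : ℂ)⁻¹ • x) = 0
        rw [map_smul, show p.2.1 x = 0 from this, smul_zero])
  have hidx : ∀ k, k ≤ (g k).2.2 := by
    intro k
    induction k with
    | zero => exact Nat.zero_le _
    | succ k ih => exact Nat.succ_le_of_lt (ih.trans_lt (hr k (k + 1) k.lt_succ_self).2)
  set x : ℕ → Y := fun k => (g k).1 with hxdef
  have hcoef := norm_coeff_le_of_triangular (x := x) (f := fun k => (g k).2.1)
    (fun k => (hP k).2.1) (fun k => (hP k).1) (fun k => (hP k).2.2.1) (fun k j h => (hr k j h).1)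
  have hTx : ∀ k, ‖T (x k)‖ ≤ 4⁻¹ ^ (k + 1) := fun k => (hP k).2.2.2.trans
    (pow_le_pow_of_le_one (by norm_num) (by norm_num) (Nat.succ_le_succ (hidx k)))
  have hlin : LinearIndependent ℂ x := by
    rw [linearIndependent_iff']
    intro s a hs i hi
    obtain ⟨N, hN⟩ := s.exists_nat_subset_range
    have hsum : ∑ k ∈ Finset.range N, (if k ∈ s then a k else 0) • x k = 0 := by
      simp only [ite_smul, zero_smul]
      rw [← Finset.sum_filter, Finset.filter_mem_eq_inter, Finset.inter_eq_right.2 hN, hs]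
    have := hcoef (fun k => if k ∈ s then a k else 0) N i (Finset.mem_range.1 (hN hi))
    rw [hsum, norm_zero, mul_zero] at this
    simpa [hi] using this
  refine ⟨Submodule.span ℂ (Set.range x), fun hfin => ?_, fun v hv => ?_⟩
  · have := (linearIndependent_span hlin).finite
    exact not_finite ℕ
  · obtain ⟨c, rfl⟩ := Finsupp.mem_span_range_iff_exists_finsupp.1 hv
    obtain ⟨N, hN⟩ := c.support.exists_nat_subset_range
    rw [Finsupp.sum_of_support_subset c hN (fun i a => a • x i) (fun i _ => zero_smul _ _)]
    set v := ∑ i ∈ Finset.range N, c i • x i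
    rw [map_sum]
    have hgeom : ∑ i ∈ Finset.range N, (2⁻¹ : ℝ) ^ i ≤ 2 := by
      have h := sum_geometric_two_le N
      simpa only [one_div] using h
    calc ‖∑ i ∈ Finset.range N, T (c i • x i)‖
        ≤ ∑ i ∈ Finset.range N, 2⁻¹ ^ i * (4⁻¹ * ‖v‖) := by
          refine norm_sum_le_of_le _ fun i hi => ?_
          rw [map_smul, norm_smul]
          calc ‖c i‖ * ‖T (x i)‖ ≤ (2 ^ i * ‖v‖) * 4⁻¹ ^ (i + 1) := by
                gcongr
                · exact hcoef c N i (Finset.mem_range.1 hi)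
                · exact hTx i
            _ = (2 * 4⁻¹) ^ i * (4⁻¹ * ‖v‖) := by rw [mul_pow, pow_succ]; ring
            _ = 2⁻¹ ^ i * (4⁻¹ * ‖v‖) := by norm_num
      _ ≤ 2 * (4⁻¹ * ‖v‖) := by
          rw [← Finset.sum_mul]; gcongr
      _ = 2⁻¹ * ‖v‖ := by ring

theorem IsStrictlySingular.smul {K : Y →L[ℂ] Y} (hK : IsStrictlySingular K) (t : ℂ) :
    IsStrictlySingular (t • K) := by
  rintro V ⟨c, hc, h⟩
  refine hK V ⟨c / (‖t‖ + 1), by positivity, fun x hx => ?_⟩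
  have h1 := h x hx
  rw [smul_apply, norm_smul] at h1
  rw [div_mul_eq_mul_div, div_le_iff₀ (by positivity)]
  nlinarith [norm_nonneg (K x)]

theorem IsStrictlySingular.exists_boundedBelowOn_one_add {K : Y →L[ℂ] Y}
    (hK : IsStrictlySingular K) :
    ∃ M : Submodule ℂ Y, IsClosed (M : Set Y) ∧ M.CoFG ∧ BoundedBelowOn (1 + K) M := by
  by_contra! hcon
  obtain ⟨V, hV, h⟩ := exists_infiniteDimensional_norm_le hcon
  refine hV (hK V ⟨2⁻¹, by norm_num, fun x hx => ?_⟩)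
  have h1 : ‖x‖ ≤ ‖(1 + K) x‖ + ‖K x‖ := by
    have := norm_sub_le ((1 + K) x) (K x)
    simpa using this
  linarith [h x hx]

/-- The identity plus a strictly singular operator is a Fredholm operator of index zero. The
set of all real `t` for which `1 + t • K` is such an operator is open and closed, and
contains `0`. -/
theorem IsStrictlySingular.isWeyl_one_add [CompleteSpace Y] {K : Y →L[ℂ] Y}
    (hK : IsStrictlySingular K) : IsWeyl (1 + K) := by
  let p : ℝ → (Y →L[ℂ] Y) := fun t => 1 + (t : ℂ) • K
  have hp : Continuous p := by fun_prop
  have hclopen : IsClopen (p ⁻¹' {T | IsWeyl T}) := by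
    refine ⟨isClosed_of_closure_subset fun t ht => ?_, isOpen_isWeyl.preimage hp⟩
    obtain ⟨M, hM, hfin, hb⟩ := (hK.smul (t : ℂ)).exists_boundedBelowOn_one_add
    exact hb.isWeyl_of_mem_closure hM hfin (map_mem_closure hp ht fun _ h => h)
  have huniv := hclopen.eq_univ ⟨0, by
    have : IsWeyl (1 : Y →L[ℂ] Y) := isWeyl_of_isUnit isUnit_one
    simpa [p] using this⟩
  have h1 : (1 : ℝ) ∈ p ⁻¹' {T | IsWeyl T} := by rw [huniv]; trivial
  simpa [p] using h1

end StrictlySingular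

/-! ### Idempotent matrices over stably finite rings -/

section VMonoid

theorem Equiv₀.eq_zero {m n A : Type*} [Fintype m] [Fintype n] [NonUnitalRing A]
    {P : Matrix m m A} (hP : IsIdempotentElem P) (h : Equiv₀ P (0 : Matrix n n A)) : P = 0 := by
  obtain ⟨R, T, h₁, h₂⟩ := h
  calc P = P * P := hP.eq.symm
    _ = R * (T * R) * T := by rw [h₁]; simp only [Matrix.mul_assoc]
    _ = 0 := by rw [← h₂]; simp

theorem V.mk_eq_zero {A : Type v} [NonUnitalRing A] {n : ℕ} {P : Matrix (Fin n) (Fin n) A}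
    {hP : IsIdempotentElem P} (h : V.mk P hP = 0) : P = 0 :=
  Equiv₀.eq_zero hP (Quotient.exact h)

theorem V.exists_mk {A : Type v} [NonUnitalRing A] (c : V A) :
    ∃ (n : ℕ) (P : Matrix (Fin n) (Fin n) A) (hP : IsIdempotentElem P), c = V.mk P hP := by
  obtain ⟨⟨n, P, hP⟩, rfl⟩ := Quotient.exists_rep c
  exact ⟨n, P, hP, rfl⟩

/-- `V(A)` is conical. -/
theorem V.eq_zero_of_add_eq_zero {A : Type v} [NonUnitalRing A] {c d : V A} (h : c + d = 0) :
    d = 0 := by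
  obtain ⟨m, P, hP, rfl⟩ := V.exists_mk c
  obtain ⟨n, Q, hQ, rfl⟩ := V.exists_mk d
  rw [V.mk_add_mk] at h
  have h0 := V.mk_eq_zero h
  have hQ0 : Q = 0 := by
    ext i j
    have := congrFun (congrFun h0 (finSumFinEquiv (Sum.inr i))) (finSumFinEquiv (Sum.inr j))
    simpa [blockSum] using this
  subst hQ0
  exact V.mk_zero n

theorem isIdempotentElem_add {R : Type*} [NonUnitalRing R] {p q : R} (hp : IsIdempotentElem p)
    (hq : IsIdempotentElem q) (hpq : p * q = 0) (hqp : q * p = 0) :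
    IsIdempotentElem (p + q) := by
  rw [IsIdempotentElem, mul_add, add_mul, add_mul, hp.eq, hq.eq, hpq, hqp, add_zero, zero_add]

theorem V.mk_add_mk_of_orthogonal {A : Type v} [Ring A] {n : ℕ}
    {P Q : Matrix (Fin n) (Fin n) A} (hP : IsIdempotentElem P) (hQ : IsIdempotentElem Q)
    (hPQ : P * Q = 0) (hQP : Q * P = 0) :
    V.mk P hP + V.mk Q hQ = V.mk (P + Q) (isIdempotentElem_add hP hQ hPQ hQP) := by
  rw [V.mk_add_mk]
  refine V.sound _ _ ?_
  have i := isIdempotentElem_fromBlocks hP hQ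
  refine (Equiv₀.reindex i _).symm.trans (isIdempotentElem_blockSum hP hQ)
    (isIdempotentElem_add hP hQ hPQ hQP) ⟨Matrix.fromRows P Q, Matrix.fromCols P Q, ?_, ?_⟩
  · rw [Matrix.fromRows_mul_fromCols, hP.eq, hQ.eq, hPQ, hQP]
  · rw [Matrix.fromCols_mul_fromRows, hP.eq, hQ.eq]

/-- Over a stably finite ring, adding a non-zero idempotent matrix to an identity matrix changes
its class. -/
theorem V.eq_zero_of_add_mk_one {A : Type v} [Ring A] [IsStablyFiniteRing A] {n : ℕ} {c : V A}
    (h : c + V.mk (1 : Matrix (Fin n) (Fin n) A) IsIdempotentElem.one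
      = V.mk (1 : Matrix (Fin n) (Fin n) A) IsIdempotentElem.one) : c = 0 := by
  obtain ⟨m, S, hS, rfl⟩ := V.exists_mk c
  have i := isIdempotentElem_fromBlocks hS (IsIdempotentElem.one (M := Matrix (Fin n) (Fin n) A))
  rw [V.mk_add_mk] at h
  obtain ⟨R, T, h₁, h₂⟩ : Equiv₀ (Matrix.fromBlocks S 0 0 (1 : Matrix (Fin n) (Fin n) A))
      (1 : Matrix (Fin n) (Fin n) A) :=
    (Equiv₀.reindex i _).trans i IsIdempotentElem.one (Quotient.exact h)
  rw [← Matrix.fromRows_toRows R, ← Matrix.fromCols_toCols T,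
    Matrix.fromRows_mul_fromCols, Matrix.fromBlocks_inj] at h₁
  obtain ⟨h11, h12, -, h22⟩ := h₁
  -- The lower right block is a left inverse, hence a two-sided one.
  have h22' := mul_eq_one_symm h22.symm
  have hR : R.toRows₁ = 0 := by
    rw [← Matrix.mul_one R.toRows₁, ← h22', ← Matrix.mul_assoc, ← h12, Matrix.zero_mul]
  rw [hR, Matrix.zero_mul] at h11
  subst h11
  exact V.mk_zero m

theorem K0Unital.mk_eq_mk {A : Type v} [Ring A] {m n : ℕ} {P : Matrix (Fin m) (Fin m) A}
    {Q : Matrix (Fin n) (Fin n) A} (hP : IsIdempotentElem P) (hQ : IsIdempotentElem Q)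
    (h : Equiv₀ P Q) : K0Unital.mk P hP = K0Unital.mk Q hQ := by
  rw [K0Unital.mk, K0Unital.mk, V.sound hP hQ h]

theorem K0Unital.mk_add_mk_of_orthogonal {A : Type v} [Ring A] {n : ℕ}
    {P Q : Matrix (Fin n) (Fin n) A} (hP : IsIdempotentElem P) (hQ : IsIdempotentElem Q)
    (hPQ : P * Q = 0) (hQP : Q * P = 0) :
    K0Unital.mk P hP + K0Unital.mk Q hQ
      = K0Unital.mk (P + Q) (isIdempotentElem_add hP hQ hPQ hQP) := by
  simp only [K0Unital.mk, ← map_add, V.mk_add_mk_of_orthogonal hP hQ hPQ hQP]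

theorem K0Unital.sum_mk {A : Type v} [Ring A] {n : ℕ} {ι : Type*}
    {e : ι → Matrix (Fin n) (Fin n) A}
    (he : OrthogonalIdempotents e) (s : Finset ι) :
    ∑ i ∈ s, K0Unital.mk (e i) (he.idem i)
      = K0Unital.mk (∑ i ∈ s, e i) he.isIdempotentElem_sum := by
  classical
  induction s using Finset.induction_on with
  | empty =>
    simp only [Finset.sum_empty]
    exact (K0Unital.mk_zero n).symm
  | insert i s hi ih =>
    simp only [Finset.sum_insert hi, ih]
    exact K0Unital.mk_add_mk_of_orthogonal _ _ (he.mul_sum_of_notMem hi)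
      (by
        rw [Finset.sum_mul]
        exact Finset.sum_eq_zero fun j hj => he.ortho fun h => hi (h ▸ hj))

/-- Over a stably finite ring, no non-zero idempotent matrix has a class of finite order. -/
theorem K0Unital.eq_zero_of_nsmul_mk_eq_zero {A : Type v} [Ring A] [IsStablyFiniteRing A] {n : ℕ}
    {Q : Matrix (Fin n) (Fin n) A} {hQ : IsIdempotentElem Q} {k : ℕ} (hk : k ≠ 0)
    (h : k • K0Unital.mk Q hQ = 0) : Q = 0 := by
  rw [K0Unital.mk, ← map_nsmul, ← map_zero (Algebra.GrothendieckAddGroup.of (M := V A))] at h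
  obtain ⟨c, hc⟩ := ((AddLocalization.addMonoidOf (⊤ : AddSubmonoid (V A))).eq_iff_exists).1 h
  obtain ⟨N, R, hR, hcR⟩ := V.exists_mk (c : V A)
  -- Stabilise `R` to an identity matrix by adding `1 - R`.
  have h1 : V.mk R hR + V.mk (1 - R) hR.one_sub
      = V.mk (1 : Matrix (Fin N) (Fin N) A) IsIdempotentElem.one := by
    rw [V.mk_add_mk_of_orthogonal hR hR.one_sub (by rw [mul_sub, mul_one, hR.eq, sub_self])
      (by rw [sub_mul, one_mul, hR.eq, sub_self])]
    simp only [add_sub_cancel]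
  rw [hcR, add_zero] at hc
  have h2 : k • V.mk Q hQ + V.mk (1 : Matrix (Fin N) (Fin N) A) IsIdempotentElem.one
      = V.mk (1 : Matrix (Fin N) (Fin N) A) IsIdempotentElem.one := by
    rw [← h1, ← add_assoc, add_comm (k • _), hc]
  have h3 := V.eq_zero_of_add_mk_one h2
  obtain ⟨k, rfl⟩ := Nat.exists_eq_succ_of_ne_zero hk
  rw [succ_nsmul] at h3
  exact V.mk_eq_zero (V.eq_zero_of_add_eq_zero h3)

end VMonoid

/-! ### Matrices of operators as operators on a power of the space -/

section MatrixOp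

variable {X : Type u} [NormedAddCommGroup X] [NormedSpace ℂ X]

theorem matrixOp_apply {n : ℕ} (T : Matrix (Fin n) (Fin n) (X →L[ℂ] X)) (x : Fin n → X)
    (k : Fin n) : matrixOp T x k = ∑ l, T k l (x l) := by
  simp [matrixOp]

/-- The entries of an operator on `X ^ n`. -/
noncomputable def opEntries {n : ℕ} (S : (Fin n → X) →L[ℂ] (Fin n → X)) :
    Matrix (Fin n) (Fin n) (X →L[ℂ] X) :=
  Matrix.of fun k l =>
    (ContinuousLinearMap.proj k).comp (S.comp (ContinuousLinearMap.single ℂ (fun _ => X) l))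

theorem opEntries_apply {n : ℕ} (S : (Fin n → X) →L[ℂ] (Fin n → X)) (k l : Fin n) (x : X) :
    opEntries S k l x = S (Pi.single l x) k := rfl

theorem matrixOp_opEntries {n : ℕ} (S : (Fin n → X) →L[ℂ] (Fin n → X)) :
    matrixOp (opEntries S) = S := by
  ext x k
  simp only [matrixOp_apply, opEntries_apply]
  rw [← Finset.sum_apply, ← map_sum, LinearMap.sum_single_apply]

theorem opEntries_matrixOp {n : ℕ} (T : Matrix (Fin n) (Fin n) (X →L[ℂ] X)) :
    opEntries (matrixOp T) = T := by
  ext k l x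
  rw [opEntries_apply, matrixOp_apply, Finset.sum_eq_single l]
  · rw [Pi.single_eq_same]
  · intro j _ hj
    rw [Pi.single_eq_of_ne hj, map_zero]
  · simp

/-- The identification of matrices of operators on `X` with operators on `X ^ n`. -/
noncomputable def matrixOpEquiv (X : Type u) [NormedAddCommGroup X] [NormedSpace ℂ X] (n : ℕ) :
    Matrix (Fin n) (Fin n) (X →L[ℂ] X) ≃+* ((Fin n → X) →L[ℂ] (Fin n → X)) where
  toFun := matrixOp
  invFun := opEntries
  left_inv := opEntries_matrixOp
  right_inv := matrixOp_opEntries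
  map_mul' S T := by
    ext x k
    simp only [mul_apply_eq_comp, matrixOp_apply, Matrix.mul_apply,
      _root_.sum_apply, map_sum]
    exact Finset.sum_comm
  map_add' S T := by
    ext x k
    simp [matrixOp_apply, Finset.sum_add_distrib]

theorem opEntries_mem_finiteRank {n : ℕ} {S : (Fin n → X) →L[ℂ] (Fin n → X)}
    (hS : S ∈ finiteRank (Fin n → X)) (k l : Fin n) : opEntries S k l ∈ finiteRank X := by
  have : FiniteDimensional ℂ (LinearMap.range (S : (Fin n → X) →ₗ[ℂ] (Fin n → X))) := hS
  refine Submodule.finiteDimensional_of_le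
    (S₂ := (LinearMap.range (S : (Fin n → X) →ₗ[ℂ] (Fin n → X))).map (LinearMap.proj k)) ?_
  rintro _ ⟨x, rfl⟩
  exact ⟨S (Pi.single l x), ⟨_, rfl⟩, rfl⟩

theorem matrixOp_mem_finiteRank {n : ℕ} {T : Matrix (Fin n) (Fin n) (X →L[ℂ] X)}
    (hT : ∀ k l, T k l ∈ finiteRank X) : matrixOp T ∈ finiteRank (Fin n → X) := by
  have : ∀ k l, FiniteDimensional ℂ (LinearMap.range (T k l : X →ₗ[ℂ] X)) := hT
  refine Submodule.finiteDimensional_of_le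
    (S₂ := ⨆ k, ⨆ l, (LinearMap.range (T k l : X →ₗ[ℂ] X)).map
      (LinearMap.single ℂ (fun _ => X) k)) ?_
  rintro _ ⟨x, rfl⟩
  change matrixOp T x ∈ _
  rw [← LinearMap.sum_single_apply (fun _ => X) (matrixOp T x)]
  refine Submodule.sum_mem _ fun k _ => ?_
  rw [matrixOp_apply]
  change LinearMap.single ℂ (fun _ => X) k _ ∈ _
  rw [map_sum]
  exact Submodule.sum_mem _ fun l _ =>
    Submodule.mem_iSup_of_mem k (Submodule.mem_iSup_of_mem l ⟨_, ⟨x l, rfl⟩, rfl⟩)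

instance instInfDimBanachPi [InfDimBanach X] {n : ℕ} [NeZero n] : InfDimBanach (Fin n → X) where
  not_finiteDimensional := fun _ => InfDimBanach.not_finiteDimensional (X := X) <|
    FiniteDimensional.of_surjective (LinearMap.proj (R := ℂ) (φ := fun _ : Fin n => X) 0)
      (Function.surjective_eval 0)

/-- A matrix of members of an ideal of strictly singular operators is strictly singular. -/
theorem OperatorIdeal.ContainedInStrictlySingular.matrixOp {J : OperatorIdeal.{u}}
    (hsing : J.ContainedInStrictlySingular) [InfDimBanach X] {n : ℕ}
    {T : Matrix (Fin n) (Fin n) (X →L[ℂ] X)} (hT : ∀ k l, T k l ∈ J.alg X) :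
    IsStrictlySingular (matrixOp T) := by
  rcases Nat.eq_zero_or_pos n with rfl | hn
  · intro V _
    infer_instance
  have : NeZero n := ⟨hn.ne'⟩
  refine hsing _ _ _ ?_
  have e : OpK.matrixOp T = ∑ k, ∑ l, (ContinuousLinearMap.single ℂ (fun _ => X) k).comp
      ((T k l).comp (ContinuousLinearMap.proj l)) := by
    ext x i
    rw [matrixOp_apply]
    simp only [_root_.sum_apply, Finset.sum_apply]
    refine ((Finset.sum_eq_single i ?_ ?_).trans ?_).symm
    · intro j _ hj
      exact Finset.sum_eq_zero fun l _ =>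
        Pi.single_eq_of_ne (M := fun _ => X) hj.symm (T j l (x l))
    · simp
    · exact Finset.sum_congr rfl fun l _ =>
        Pi.single_eq_same (M := fun _ => X) i (T i l (x l))
  rw [e]
  exact Submodule.sum_mem _ fun k _ => Submodule.sum_mem _ fun l _ =>
    J.comp_mem _ _ _ _ _ _ _ (hT k l)

end MatrixOp


/-! ### Matrices over the unitization of an ideal of strictly singular operators -/

section Unitization

variable {X : Type u} [NormedAddCommGroup X] [NormedSpace ℂ X]
  {A : Type v} [NonUnitalRing A] [Module ℂ A] [IsScalarTower ℂ A A] [SMulCommClass ℂ A A]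

/-- The representation `ι` identifies the algebra `A` with a proper left ideal of `B(X)` that
contains the finite-rank operators and over which all square matrices are strictly singular. -/
structure IsSingularIdeal (ι : A →ₙₐ[ℂ] (X →L[ℂ] X)) : Prop where
  injective : Function.Injective ι
  ne_one : ∀ a, ι a ≠ 1
  exists_mul : ∀ (T : X →L[ℂ] X) (a : A), ∃ b, ι b = T * ι a
  exists_finiteRank : ∀ F ∈ finiteRank X, ∃ a, ι a = F
  strictlySingular : ∀ (n : ℕ) (K : Matrix (Fin n) (Fin n) A),
    IsStrictlySingular (matrixOp (K.map ι))

theorem OperatorIdeal.ContainedInStrictlySingular.isSingularIdeal {J : OperatorIdeal.{u}}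
    (hJ : J.NonZero) (hsing : J.ContainedInStrictlySingular) (X : Type u)
    [NormedAddCommGroup X] [NormedSpace ℂ X] [InfDimBanach X] :
    IsSingularIdeal (NonUnitalSubalgebraClass.subtype (J.alg X)) where
  injective := Subtype.val_injective
  ne_one := fun a h => by
    have ha : (1 : X →L[ℂ] X) ∈ J.ops X X := h ▸ a.2
    have := hsing X X _ ha ⊤ ⟨1, one_pos, fun x _ => by simp⟩
    exact InfDimBanach.not_finiteDimensional (X := X)
      (Module.Finite.equiv (Submodule.topEquiv (R := ℂ) (M := X)))
  exists_mul := fun T a =>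
    ⟨⟨T * a, J.comp_mem X X X X (ContinuousLinearMap.id ℂ X) a T a.2⟩, rfl⟩
  exists_finiteRank := fun F hF => ⟨⟨F, hJ.finiteRank_le X hF⟩, rfl⟩
  strictlySingular := fun _ K => hsing.matrixOp fun k l => (K k l).2

variable (ι : A →ₙₐ[ℂ] (X →L[ℂ] X))

/-- The matrix over the unitization of `A` given by a matrix over `A`. -/
abbrev matrixInr {m n : Type*} (K : Matrix m n A) : Matrix m n (Unitization ℂ A) :=
  K.map (Unitization.inrNonUnitalAlgHom ℂ A)

/-- A matrix over the unitization of `A`, acting as an operator on `X ^ n`. -/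
noncomputable def unitizationOp (n : ℕ) :
    Matrix (Fin n) (Fin n) (Unitization ℂ A) →+* ((Fin n → X) →L[ℂ] (Fin n → X)) :=
  ((matrixOpEquiv X n : _ ≃+* _) : _ →+* _).comp (Unitization.lift ι).toRingHom.mapMatrix

theorem unitizationOp_eq {n : ℕ} (P : Matrix (Fin n) (Fin n) (Unitization ℂ A)) :
    unitizationOp ι n P = matrixOp (P.map (Unitization.lift ι)) := rfl

theorem unitizationOp_matrixInr {n : ℕ} (K : Matrix (Fin n) (Fin n) A) :
    unitizationOp ι n (matrixInr K) = matrixOp (K.map ι) := by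
  rw [unitizationOp_eq]
  congr 1
  ext k l : 2
  simp

theorem opEntries_unitizationOp {n : ℕ} (P : Matrix (Fin n) (Fin n) (Unitization ℂ A)) :
    opEntries (unitizationOp ι n P) = P.map (Unitization.lift ι) := opEntries_matrixOp _

theorem scalarMap_matrixInr {n : ℕ} (K : Matrix (Fin n) (Fin n) A) :
    (scalarMap A).mapMatrix (matrixInr K) = 0 := by
  ext k l <;> simp [scalarMap]

theorem scalarMap_mapMatrix_idem {n : ℕ} (P : Matrix (Fin n) (Fin n) (Unitization ℂ A)) :
    (scalarMap A).mapMatrix ((scalarMap A).mapMatrix P) = (scalarMap A).mapMatrix P := by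
  ext k l <;> simp [scalarMap]

theorem exists_matrixInr_of_scalarMap_eq_zero {n : ℕ}
    {P : Matrix (Fin n) (Fin n) (Unitization ℂ A)} (hP : (scalarMap A).mapMatrix P = 0) :
    ∃ K : Matrix (Fin n) (Fin n) A, P = matrixInr K := by
  refine ⟨P.map fun p => p.snd, ?_⟩
  ext k l
  · have := congrArg (fun p : Unitization ℂ A => p.fst) (congrFun (congrFun hP k) l)
    simpa [scalarMap, Unitization.algebraMap_eq_inl] using this
  · simp

theorem exists_eq_one_add_matrixInr {n : ℕ} {Z : Matrix (Fin n) (Fin n) (Unitization ℂ A)}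
    (hZ : (scalarMap A).mapMatrix Z = 1) :
    ∃ K : Matrix (Fin n) (Fin n) A, Z = 1 + matrixInr K := by
  obtain ⟨K, hK⟩ := exists_matrixInr_of_scalarMap_eq_zero (P := Z - 1)
    (by rw [map_sub, hZ, map_one, sub_self])
  exact ⟨K, by rw [← hK]; abel⟩

namespace IsSingularIdeal

variable {ι}

theorem lift_injective (h : IsSingularIdeal ι) : Function.Injective (Unitization.lift ι) := by
  refine (injective_iff_map_eq_zero _).2 fun x hx => ?_
  induction x with
  | inl_add_inr z a =>
    have hx' : algebraMap ℂ (X →L[ℂ] X) z + ι a = 0 := by simpa using hx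
    by_cases hz : z = 0
    · subst hz
      have ha : ι a = 0 := by simpa using hx'
      rw [h.injective (ha.trans (map_zero ι).symm)]
      simp
    · refine absurd ?_ (h.ne_one (-(z⁻¹ • a)))
      rw [map_neg, map_smul, eq_neg_of_add_eq_zero_right hx', Algebra.algebraMap_eq_smul_one,
        smul_neg, neg_neg, inv_smul_smul₀ hz]

theorem unitizationOp_injective (h : IsSingularIdeal ι) (n : ℕ) :
    Function.Injective (unitizationOp ι n) :=
  (matrixOpEquiv X n).injective.comp (Matrix.map_injective h.lift_injective)

theorem exists_matrixInr_eq {n : ℕ} {S : (Fin n → X) →L[ℂ] (Fin n → X)}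
    (hS : ∀ k l, ∃ a, ι a = opEntries S k l) :
    ∃ K : Matrix (Fin n) (Fin n) A, unitizationOp ι n (matrixInr K) = S := by
  choose K hK using hS
  refine ⟨Matrix.of K, ?_⟩
  rw [unitizationOp_matrixInr, ← matrixOp_opEntries S]
  congr 1
  ext k l : 2
  exact DFunLike.congr_fun (hK k l) _

theorem exists_matrixInr_of_mem_finiteRank (h : IsSingularIdeal ι) {n : ℕ}
    {F : (Fin n → X) →L[ℂ] (Fin n → X)}
    (hF : F ∈ finiteRank (Fin n → X)) :
    ∃ K : Matrix (Fin n) (Fin n) A, unitizationOp ι n (matrixInr K) = F :=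
  exists_matrixInr_eq fun k l => h.exists_finiteRank _ (opEntries_mem_finiteRank hF k l)

/-- The operators coming from matrices over `A` form a left ideal of the operators on `X ^ n`. -/
theorem exists_matrixInr_mul (h : IsSingularIdeal ι) {n : ℕ} (S : (Fin n → X) →L[ℂ] (Fin n → X))
    (K : Matrix (Fin n) (Fin n) A) : ∃ K' : Matrix (Fin n) (Fin n) A,
      unitizationOp ι n (matrixInr K') = S * unitizationOp ι n (matrixInr K) := by
  refine exists_matrixInr_eq fun k l => ?_
  have e : opEntries (S * unitizationOp ι n (matrixInr K)) = opEntries S * K.map ι := by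
    have := map_mul (matrixOpEquiv X n).symm S (unitizationOp ι n (matrixInr K))
    rw [unitizationOp_matrixInr] at this ⊢
    exact this.trans (congrArg (opEntries S * ·) (opEntries_matrixOp _))
  choose f hf using fun j => h.exists_mul (opEntries S k j) (K j l)
  refine ⟨∑ j, f j, ?_⟩
  rw [e, Matrix.mul_apply, map_sum]
  exact Finset.sum_congr rfl fun j _ => hf j

theorem isWeyl_unitizationOp (h : IsSingularIdeal ι) [CompleteSpace X] {n : ℕ}
    {Z : Matrix (Fin n) (Fin n) (Unitization ℂ A)} (hZ : (scalarMap A).mapMatrix Z = 1) :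
    IsWeyl (unitizationOp ι n Z) := by
  obtain ⟨K, rfl⟩ := exists_eq_one_add_matrixInr hZ
  rw [map_add, map_one, unitizationOp_matrixInr]
  exact (h.strictlySingular n K).isWeyl_one_add

/-- The unitization of `A` is inverse-closed in the algebra of all operators, since `A` is
a left ideal there. -/
theorem isUnit_of_isUnit_unitizationOp (h : IsSingularIdeal ι) {n : ℕ}
    {Z : Matrix (Fin n) (Fin n) (Unitization ℂ A)}
    (hZ : (scalarMap A).mapMatrix Z = 1) (hu : IsUnit (unitizationOp ι n Z)) : IsUnit Z := by
  obtain ⟨K, rfl⟩ := exists_eq_one_add_matrixInr hZ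
  obtain ⟨V, hV1, hV2⟩ := isUnit_iff_exists.1 hu
  -- The inverse of `1 + K` is `1 - (1 + K)⁻¹ K`.
  obtain ⟨K', hK'⟩ := h.exists_matrixInr_mul V K
  have hinv : unitizationOp ι n (1 - matrixInr K') = V := by
    rw [map_add, map_one, mul_add, mul_one] at hV2
    rw [map_sub, map_one, hK', ← hV2, add_sub_cancel_right]
  refine isUnit_iff_exists.2 ⟨1 - matrixInr K', ?_, ?_⟩
  · apply h.unitizationOp_injective n
    rw [map_mul, hinv, hV1, map_one]
  · apply h.unitizationOp_injective n
    rw [map_mul, hinv, hV2, map_one]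

/-- A left invertible matrix over the unitization of `A` is, up to an invertible scalar matrix, an
injective Fredholm operator of index zero, and hence invertible. -/
theorem isStablyFiniteRing_unitization (h : IsSingularIdeal ι) [CompleteSpace X] :
    IsStablyFiniteRing (Unitization ℂ A) := by
  refine ⟨fun n => ⟨fun {d b} hdb => ?_⟩⟩
  set s := (scalarMap A).mapMatrix (m := Fin n) with hs
  have hsdb : s d * s b = 1 := by rw [← map_mul, hdb, map_one]
  have hsbd : s b * s d = 1 := by
    have hfst : (Unitization.fstHom ℂ A).toRingHom.mapMatrix d
        * (Unitization.fstHom ℂ A).toRingHom.mapMatrix b = 1 := by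
      rw [← map_mul, hdb, map_one]
    have hfst' := congrArg (algebraMap ℂ (Unitization ℂ A)).mapMatrix (mul_eq_one_symm hfst)
    rwa [map_mul, map_one] at hfst'
  have hZ : s (s d * b) = 1 := by
    rw [map_mul, hs, scalarMap_mapMatrix_idem, ← hs, hsdb]
  have hleft : (d * s b) * (s d * b) = 1 := by
    rw [mul_assoc, ← mul_assoc (s b), hsbd, one_mul, hdb]
  have hinj : Function.Injective (unitizationOp ι n (s d * b)) := by
    refine Function.LeftInverse.injective (g := unitizationOp ι n (d * s b)) fun x => ?_
    have := map_mul (unitizationOp ι n) (d * s b) (s d * b)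
    rw [hleft, map_one] at this
    exact (DFunLike.congr_fun this x).symm
  have hunit := h.isUnit_of_isUnit_unitizationOp hZ
    ((h.isWeyl_unitizationOp hZ).isUnit_of_injective hinj)
  have hb : IsUnit b := by
    have e : b = s b * (s d * b) := by rw [← mul_assoc, hsbd, one_mul]
    rw [e]
    exact IsUnit.mul ⟨⟨s b, s d, hsbd, hsdb⟩, rfl⟩ hunit
  obtain ⟨c, hc, -⟩ := isUnit_iff_exists.1 hb
  rwa [left_inv_eq_right_inv hdb hc]

end IsSingularIdeal

end Unitization

/-! ### Idempotents of finite rank -/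

section FiniteRank

theorem mul_mem_finiteRank_of_left {Y : Type u} [NormedAddCommGroup Y] [NormedSpace ℂ Y]
    {F : Y →L[ℂ] Y} (hF : F ∈ finiteRank Y) (T : Y →L[ℂ] Y) : F * T ∈ finiteRank Y := by
  have : FiniteDimensional ℂ (LinearMap.range (F : Y →ₗ[ℂ] Y)) := hF
  refine Submodule.finiteDimensional_of_le (S₂ := LinearMap.range (F : Y →ₗ[ℂ] Y)) ?_
  rintro _ ⟨x, rfl⟩
  exact ⟨T x, rfl⟩

theorem smulRight_mem_finiteRank {Y : Type u} [NormedAddCommGroup Y] [NormedSpace ℂ Y]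
    (f : Y →L[ℂ] ℂ) (y : Y) : f.smulRight y ∈ finiteRank Y := by
  refine Submodule.finiteDimensional_of_le (S₂ := Submodule.span ℂ {y}) ?_
  rintro _ ⟨x, rfl⟩
  exact Submodule.smul_mem _ _ (Submodule.mem_span_singleton_self _)

/-- A finite-rank idempotent is given by a finite biorthogonal system. -/
theorem exists_biorthogonal_of_isIdempotentElem {Y : Type u} [NormedAddCommGroup Y]
    [NormedSpace ℂ Y] {r : Y →L[ℂ] Y} (hr : IsIdempotentElem r) (hfin : r ∈ finiteRank Y) {k : ℕ}
    (hk : Module.finrank ℂ (LinearMap.range (r : Y →ₗ[ℂ] Y)) = k) :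
    ∃ (b : Fin k → Y) (β : Fin k → Y →L[ℂ] ℂ),
      (∀ i j, β i (b j) = if i = j then 1 else 0) ∧ r = ∑ i, (β i).smulRight (b i) := by
  have : FiniteDimensional ℂ (LinearMap.range (r : Y →ₗ[ℂ] Y)) := hfin
  let b := Module.finBasisOfFinrankEq ℂ _ hk
  let r' : Y →L[ℂ] LinearMap.range (r : Y →ₗ[ℂ] Y) := r.codRestrict _ (fun x => ⟨x, rfl⟩)
  refine ⟨fun i => b i, fun i => (LinearMap.toContinuousLinearMap (b.coord i)).comp r',
    fun i j => ?_, ?_⟩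
  · have hb : r' (b j) = b j := by
      obtain ⟨x, hx⟩ := (b j).2
      refine Subtype.ext ?_
      change r (b j : Y) = b j
      rw [← hx]
      exact DFunLike.congr_fun hr.eq x
    simp only [ContinuousLinearMap.comp_apply, hb, LinearMap.coe_toContinuousLinearMap',
      Module.Basis.coord_apply, Module.Basis.repr_self, Finsupp.single_apply]
    simp only [eq_comm]
  · ext x
    have hx := congrArg Subtype.val (b.sum_repr (r' x))
    simp only [Submodule.coe_sum, Submodule.coe_smul] at hx
    simp only [_root_.sum_apply, ContinuousLinearMap.smulRight_apply,
      ContinuousLinearMap.comp_apply, LinearMap.coe_toContinuousLinearMap',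
      Module.Basis.coord_apply]
    rw [hx]
    rfl

/-- Finitely many finite-rank operators have a common finite-rank idempotent unit. -/
theorem exists_idempotent_unit_finiteRank {X : Type u} [NormedAddCommGroup X] [NormedSpace ℂ X]
    {ι : Type*} [Fintype ι] [DecidableEq ι] {D : ι → X →L[ℂ] X} (hD : ∀ i, D i ∈ finiteRank X) :
    ∃ g ∈ finiteRank X, IsIdempotentElem g ∧ ∀ i, g * D i = D i ∧ D i * g = D i := by
  have hfin : ∀ i, FiniteDimensional ℂ (LinearMap.range (D i : X →ₗ[ℂ] X)) := hD
  -- `e` is an idempotent with kernel the common kernel of the operators.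
  obtain ⟨e, heD, hee, hefin⟩ : ∃ e : X →L[ℂ] X, (∀ i, D i * e = D i) ∧ e * e = e ∧
      e ∈ finiteRank X := by
    let Φ : X →L[ℂ] (ι → X) := ContinuousLinearMap.pi D
    have hΦ : FiniteDimensional ℂ (LinearMap.range (Φ : X →ₗ[ℂ] (ι → X))) := by
      refine Submodule.finiteDimensional_of_le (S₂ := ⨆ i,
        (LinearMap.range (D i : X →ₗ[ℂ] X)).map (LinearMap.single ℂ (fun _ => X) i)) ?_
      rintro _ ⟨x, rfl⟩
      change Φ x ∈ _
      rw [← LinearMap.sum_single_apply (fun _ => X) (Φ x)]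
      exact Submodule.sum_mem _ fun i _ => Submodule.mem_iSup_of_mem i ⟨_, ⟨x, rfl⟩, rfl⟩
    obtain ⟨p, hp⟩ := Φ.ker_closedComplemented_of_finiteDimensional_range
    have hDp : ∀ i x, D i (p x) = 0 := fun i x => congrFun (p x).2 i
    have hΦp : ∀ x, Φ (x - p x) = Φ x := fun x => by
      have : Φ (p x) = 0 := (p x).2
      rw [map_sub, this, sub_zero]
    refine ⟨1 - (LinearMap.ker (Φ : X →ₗ[ℂ] (ι → X))).subtypeL.comp p, fun i => ?_, ?_, ?_⟩
    · ext x
      change D i (x - p x) = D i x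
      rw [map_sub, hDp, sub_zero]
    · ext x
      change (x - p x) - (p (x - (p x : X)) : X) = x - p x
      rw [map_sub, hp (p x), sub_self, ZeroMemClass.coe_zero, sub_zero]
    · let S := LinearMap.range ((1 - (LinearMap.ker (Φ : X →ₗ[ℂ] (ι → X))).subtypeL.comp p :
        X →L[ℂ] X) : X →ₗ[ℂ] X)
      let ψ : S →ₗ[ℂ] LinearMap.range (Φ : X →ₗ[ℂ] (ι → X)) :=
        (Φ : X →ₗ[ℂ] (ι → X)).rangeRestrict.comp S.subtype
      refine FiniteDimensional.of_injective ψ ((injective_iff_map_eq_zero ψ).2 ?_)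
      rintro ⟨_, x, rfl⟩ hx
      have hx0 : Φ (x - p x) = 0 := congrArg Subtype.val hx
      rw [hΦp] at hx0
      refine Subtype.ext ?_
      change x - p x = 0
      have := congrArg Subtype.val (hp ⟨x, hx0⟩)
      exact sub_eq_zero.2 this.symm
  -- `q` is an idempotent whose range contains all the ranges involved.
  obtain ⟨q, hqD, hqe, hqq, hqfin⟩ : ∃ q : X →L[ℂ] X, (∀ i, q * D i = D i) ∧ q * e = e ∧
      q * q = q ∧ q ∈ finiteRank X := by
    have : FiniteDimensional ℂ (LinearMap.range (e : X →ₗ[ℂ] X)) := hefin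
    set M := (⨆ i, LinearMap.range (D i : X →ₗ[ℂ] X)) ⊔ LinearMap.range (e : X →ₗ[ℂ] X) with hM
    have hMfin : FiniteDimensional ℂ M := by rw [hM]; infer_instance
    obtain ⟨p, hp⟩ := Submodule.ClosedComplemented.of_finiteDimensional M
    refine ⟨M.subtypeL.comp p, fun i => ?_, ?_, ?_, ?_⟩
    · ext x
      exact congrArg Subtype.val (hp ⟨D i x, Submodule.mem_sup_left
        (Submodule.mem_iSup_of_mem i ⟨x, rfl⟩)⟩)
    · ext x
      exact congrArg Subtype.val (hp ⟨e x, Submodule.mem_sup_right ⟨x, rfl⟩⟩)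
    · ext x
      exact congrArg Subtype.val (hp (p x))
    · refine Submodule.finiteDimensional_of_le (S₂ := M) ?_
      rintro _ ⟨x, rfl⟩
      exact (p x).2
  -- `1 - (q + e - e q) = (1 - e) (1 - q)`, and `1 - q` absorbs `1 - e` on its right.
  refine ⟨q + e - e * q, sub_mem (add_mem hqfin hefin) (mul_mem_finiteRank_of_right e hqfin), ?_,
    fun i => ⟨?_, ?_⟩⟩
  · have h1 : q * (e * q) = e * q := by rw [← mul_assoc, hqe]
    have h2 : e * (e * q) = e * q := by rw [← mul_assoc, hee]
    simp only [IsIdempotentElem, mul_sub, mul_add, sub_mul, add_mul, mul_assoc, hqq, hqe, hee, h1,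
      h2]
    abel
  · rw [sub_mul, add_mul, mul_assoc, hqD, add_sub_cancel_right]
  · rw [mul_sub, mul_add, ← mul_assoc, heD, add_comm, add_sub_cancel_right]

end FiniteRank

/-! ### The group `K₀` of an ideal of strictly singular operators -/

section K0

theorem K0Unital.mk_add_mk_of_add_eq {A : Type v} [Ring A] {n : ℕ}
    {P Q S : Matrix (Fin n) (Fin n) A} (hP : IsIdempotentElem P) (hQ : IsIdempotentElem Q)
    (hS : IsIdempotentElem S) (hPQ : P * Q = 0) (hQP : Q * P = 0) (h : P + Q = S) :
    K0Unital.mk P hP + K0Unital.mk Q hQ = K0Unital.mk S hS := by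
  subst h
  exact K0Unital.mk_add_mk_of_orthogonal hP hQ hPQ hQP

/-- If two idempotents `P` and `E` commute with an idempotent `G` and coincide on its complement,
the difference of their classes is carried by `G`. -/
theorem K0Unital.mk_sub_mk_eq {A : Type v} [Ring A] {n : ℕ} {P E G : Matrix (Fin n) (Fin n) A}
    (hP : IsIdempotentElem P) (hE : IsIdempotentElem E) (hG : IsIdempotentElem G)
    (hPG : Commute P G) (hEG : Commute E G) (h : P * (1 - G) = E * (1 - G)) :
    K0Unital.mk P hP - K0Unital.mk E hE
      = K0Unital.mk (P * G) (hP.mul_of_commute hPG hG)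
        - K0Unital.mk (E * G) (hE.mul_of_commute hEG hG) := by
  have key : ∀ {S : Matrix (Fin n) (Fin n) A} (hS : IsIdempotentElem S) (hSG : Commute S G),
      K0Unital.mk (S * G) (hS.mul_of_commute hSG hG)
        + K0Unital.mk (S * (1 - G))
          (hS.mul_of_commute ((Commute.one_right S).sub_right hSG) hG.one_sub)
        = K0Unital.mk S hS := by
    intro S hS hSG
    refine K0Unital.mk_add_mk_of_add_eq _ _ _ ?_ ?_ ?_
    · rw [hSG.eq, mul_assoc, ← mul_assoc S S, hS.eq, mul_sub, mul_one, hSG.eq, mul_sub,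
        ← mul_assoc, hG.eq, sub_self]
    · rw [mul_assoc, hSG.eq, ← mul_assoc (1 - G), sub_mul, one_mul, hG.eq, sub_self, zero_mul,
        mul_zero]
    · rw [← mul_add, add_sub_cancel, mul_one]
  rw [← key hP hPG, ← key hE hEG]
  simp only [h]
  abel

variable {X : Type u} [NormedAddCommGroup X] [NormedSpace ℂ X]
  {A : Type v} [NonUnitalRing A] [Module ℂ A] [IsScalarTower ℂ A A] [SMulCommClass ℂ A A]
  {ι : A →ₙₐ[ℂ] (X →L[ℂ] X)}

namespace IsSingularIdeal

/-- Factorization of the rank one operator `β ⊗ b` on `X ^ m` through `X ^ n`, as `(f ⊗ b) (β ⊗ x)`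
with `f x = 1`. -/
theorem matrix_mul_eq (h : IsSingularIdeal ι) {m n : ℕ} {b : Fin m → X}
    {f : (Fin n → X) →L[ℂ] ℂ} {x : Fin n → X} {β : (Fin m → X) →L[ℂ] ℂ}
    {R : Matrix (Fin m) (Fin n) A} {T : Matrix (Fin n) (Fin m) A}
    {P : Matrix (Fin m) (Fin m) (Unitization ℂ A)}
    (hR : ∀ k l, ι (R k l) = (f.comp (ContinuousLinearMap.single ℂ (fun _ => X) l)).smulRight (b k))
    (hT : ∀ k l, ι (T k l) = (β.comp (ContinuousLinearMap.single ℂ (fun _ => X) l)).smulRight (x k))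
    (hP : unitizationOp ι m P = β.smulRight b) (hfx : f x = 1) :
    P = matrixInr R * matrixInr T := by
  apply h.unitizationOp_injective m
  rw [hP, unitizationOp_eq]
  ext y k
  rw [matrixOp_apply]
  have hRT : ∀ l, ((matrixInr R * matrixInr T).map (Unitization.lift ι)) k l (y l)
      = β (Pi.single l (y l)) • b k := fun l => by
    have hsum : ∑ j, f (Pi.single j (x j)) = 1 := by
      rw [← map_sum, LinearMap.sum_single_apply, hfx]
    have : ∀ j, (ι (R k j) * ι (T j l)) (y l)
        = f (Pi.single j (x j)) • β (Pi.single l (y l)) • b k := fun j => by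
      rw [hR, hT]
      change f (Pi.single j (β (Pi.single l (y l)) • x j)) • b k = _
      rw [Pi.single_smul, map_smul, smul_eq_mul, mul_smul, smul_comm]
    rw [Matrix.map_apply, Matrix.mul_apply, map_sum, _root_.sum_apply]
    calc _ = ∑ j, (ι (R k j) * ι (T j l)) (y l) := by
          refine Finset.sum_congr rfl fun j _ => ?_
          rw [map_mul]
          simp
      _ = _ := by
          simp only [this]
          rw [← Finset.sum_smul, hsum, one_smul]
  simp only [hRT]
  rw [← Finset.sum_smul, ← map_sum, LinearMap.sum_single_apply]
  rfl

/-- Any two idempotent matrices of rank one are equivalent. -/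
theorem equiv₀_of_rank_one (h : IsSingularIdeal ι) {m n : ℕ}
    {P : Matrix (Fin m) (Fin m) (Unitization ℂ A)} {Q : Matrix (Fin n) (Fin n) (Unitization ℂ A)}
    {β : (Fin m → X) →L[ℂ] ℂ} {b : Fin m → X} {f : (Fin n → X) →L[ℂ] ℂ} {x : Fin n → X}
    (hP : unitizationOp ι m P = β.smulRight b) (hQ : unitizationOp ι n Q = f.smulRight x)
    (hβ : β b = 1) (hf : f x = 1) : Equiv₀ P Q := by
  choose R hR using fun k l => h.exists_finiteRank _ (smulRight_mem_finiteRank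
    (f.comp (ContinuousLinearMap.single ℂ (fun _ => X) l)) (b k))
  choose T hT using fun k l => h.exists_finiteRank _ (smulRight_mem_finiteRank
    (β.comp (ContinuousLinearMap.single ℂ (fun _ => X) l)) (x k))
  exact ⟨matrixInr (Matrix.of R), matrixInr (Matrix.of T),
    h.matrix_mul_eq hR hT hP hf, h.matrix_mul_eq hT hR hQ hβ⟩

/-- The class of a finite-rank idempotent is its rank times the class of a rank one idempotent. -/
theorem mk_eq_finrank_nsmul (h : IsSingularIdeal ι) {m n : ℕ}
    {P : Matrix (Fin m) (Fin m) (Unitization ℂ A)} {Q : Matrix (Fin n) (Fin n) (Unitization ℂ A)}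
    (hP : IsIdempotentElem P) (hQ : IsIdempotentElem Q)
    (hPfin : unitizationOp ι m P ∈ finiteRank (Fin m → X))
    {f : (Fin n → X) →L[ℂ] ℂ} {x : Fin n → X}
    (hQf : unitizationOp ι n Q = f.smulRight x) (hf : f x = 1) :
    K0Unital.mk P hP = Module.finrank ℂ
      (LinearMap.range (unitizationOp ι m P : (Fin m → X) →ₗ[ℂ] (Fin m → X)))
        • K0Unital.mk Q hQ := by
  obtain ⟨b, β, hbβ, hsum⟩ :=
    exists_biorthogonal_of_isIdempotentElem (hP.map (unitizationOp ι m)) hPfin rfl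
  choose e he using fun i => h.exists_matrixInr_of_mem_finiteRank
    (smulRight_mem_finiteRank (β i) (b i))
  have horth : OrthogonalIdempotents fun i => matrixInr (e i) := by
    rw [OrthogonalIdempotents.iff_mul_eq]
    intro i j
    apply h.unitizationOp_injective m
    rw [map_mul, he, he]
    have : (β i).smulRight (b i) * (β j).smulRight (b j)
        = if i = j then (β i).smulRight (b i) else 0 := by
      ext y : 1
      change β i (β j y • b j) • b i = _
      rw [map_smul, hbβ]
      split_ifs with hij
      · subst hij
        simp
      · simp
    rw [this]
    split_ifs
    · exact (he i).symm
    · exact (map_zero _).symm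
  have hPsum : ∑ i, matrixInr (e i) = P := by
    apply h.unitizationOp_injective m
    rw [map_sum]
    exact (Finset.sum_congr rfl fun i _ => he i).trans hsum.symm
  have hclass := K0Unital.sum_mk horth Finset.univ
  rw [K0Unital.mk_eq_mk horth.isIdempotentElem_sum hP (by rw [hPsum]; exact Equiv₀.refl hP)]
    at hclass
  rw [← hclass, Finset.sum_congr rfl fun i _ => K0Unital.mk_eq_mk (horth.idem i) hQ
    (h.equiv₀_of_rank_one (he i) hQf (by rw [hbβ, if_pos rfl]) hf)]
  rw [Finset.sum_const, Finset.card_univ, Fintype.card_fin]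

/-- Every idempotent matrix `P` over the unitization of `A` is similar to a finite-rank
perturbation of its scalar part `E`. Indeed `Z = P E + (1 - P) (1 - E)` intertwines `E` and
`P`, and it is an invertible operator up to one of finite rank. -/
theorem exists_equiv₀_finiteRank_perturbation [CompleteSpace X] (h : IsSingularIdeal ι) {n : ℕ}
    {P : Matrix (Fin n) (Fin n) (Unitization ℂ A)} (hP : IsIdempotentElem P) :
    ∃ P' : Matrix (Fin n) (Fin n) (Unitization ℂ A), IsIdempotentElem P' ∧ Equiv₀ P P' ∧
      unitizationOp ι n (P' - (scalarMap A).mapMatrix P) ∈ finiteRank (Fin n → X) := by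
  set E := (scalarMap A).mapMatrix P with hE
  have hEE : E * E = E := isIdempotentElem_mapMatrix (scalarMap A) hP
  set Z := P * E + (1 - P) * (1 - E) with hZ
  have hZs : (scalarMap A).mapMatrix Z = 1 := by
    rw [hZ, map_add, map_mul, map_mul, map_sub, map_sub, map_one, scalarMap_mapMatrix_idem, ← hE,
      hEE, sub_mul, one_mul, mul_sub, mul_one, hEE]
    abel
  have hPZ : P * Z = Z * E := by
    rw [hZ, mul_add, add_mul, ← mul_assoc, hP.eq, ← mul_assoc P (1 - P), mul_sub P, mul_one,
      hP.eq, sub_self, zero_mul, mul_assoc P, hEE, mul_assoc (1 - P), sub_mul 1 E, one_mul, hEE,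
      sub_self, mul_zero]
  obtain ⟨W, F, hW, hF, hWF⟩ := h.isWeyl_unitizationOp hZs
  obtain ⟨K, hK⟩ := h.exists_matrixInr_of_mem_finiteRank hF
  obtain ⟨V, hV1, hV2⟩ := isUnit_iff_exists.1 <|
    h.isUnit_of_isUnit_unitizationOp (Z := Z - matrixInr K)
      (by rw [map_sub, hZs, scalarMap_matrixInr, sub_zero])
      (by rwa [map_sub, hWF, hK, add_sub_cancel_right])
  set k := matrixInr K
  refine ⟨V * (P * (Z - k)), ?_, ⟨P * (Z - k), V * P, ?_, ?_⟩, ?_⟩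
  · rw [IsIdempotentElem]
    calc V * (P * (Z - k)) * (V * (P * (Z - k)))
        = V * (P * (((Z - k) * V) * (P * (Z - k)))) := by simp only [mul_assoc]
      _ = V * (P * (Z - k)) := by rw [hV1, one_mul, ← mul_assoc P, hP.eq]
  · calc P = P * ((Z - k) * V) * P := by rw [hV1, mul_one, hP.eq]
      _ = P * (Z - k) * (V * P) := by simp only [mul_assoc]
  · rw [mul_assoc V P, ← mul_assoc P, hP.eq]
  · have : V * (P * (Z - k)) - E = V * (k * E - P * k) := by
      calc V * (P * (Z - k)) - E = V * (P * (Z - k)) - V * (Z - k) * E := by rw [hV2, one_mul]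
        _ = V * (k * E - P * k) := by
          rw [mul_assoc V, ← mul_sub, mul_sub P, sub_mul, hPZ]
          congr 1
          abel
    rw [this, map_mul, map_sub, map_mul, map_mul, hK]
    exact mul_mem_finiteRank_of_right _ (sub_mem (mul_mem_finiteRank_of_left hF _)
      (mul_mem_finiteRank_of_right _ hF))

/-- If an idempotent differs from an idempotent scalar matrix by a matrix of finite rank, the
difference of the two classes is a multiple of the class of a rank one idempotent. -/
theorem mk_sub_mk_mem_of_finiteRank (h : IsSingularIdeal ι) {m n : ℕ}
    {E D : Matrix (Fin m) (Fin m) (Unitization ℂ A)} {Q : Matrix (Fin n) (Fin n) (Unitization ℂ A)}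
    (hP : IsIdempotentElem (E + D)) (hE : IsIdempotentElem E)
    (hEc : ∀ (a : Unitization ℂ A) i j, Commute (E i j) a)
    (hfin : unitizationOp ι m D ∈ finiteRank (Fin m → X)) (hQ : IsIdempotentElem Q)
    {f : (Fin n → X) →L[ℂ] ℂ} {x : Fin n → X}
    (hQf : unitizationOp ι n Q = f.smulRight x) (hf : f x = 1) :
    K0Unital.mk (E + D) hP - K0Unital.mk E hE ∈ AddSubgroup.zmultiples (K0Unital.mk Q hQ) := by
  obtain ⟨g, hgfin, hg, hgD⟩ := exists_idempotent_unit_finiteRank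
    (D := fun p : Fin m × Fin m => opEntries (unitizationOp ι m D) p.1 p.2)
    (fun p => opEntries_mem_finiteRank hfin p.1 p.2)
  simp only [opEntries_unitizationOp, Matrix.map_apply] at hgD
  obtain ⟨a, ha⟩ := h.exists_finiteRank g hgfin
  have ha' : Unitization.lift ι (a : Unitization ℂ A) = g := by simp [ha]
  -- The diagonal matrix with entries `a` commutes with scalar matrices and is a unit for `D`.
  set G : Matrix (Fin m) (Fin m) (Unitization ℂ A) :=
    Matrix.diagonal fun _ => (a : Unitization ℂ A) with hG
  have haa : (a : Unitization ℂ A) * a = a := h.lift_injective (by rw [map_mul, ha', hg.eq])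
  have hGG : IsIdempotentElem G := by
    rw [IsIdempotentElem, hG, Matrix.diagonal_mul_diagonal]
    simp only [haa]
  have hGD : G * D = D := by
    refine Matrix.ext fun i j => ?_
    rw [hG, Matrix.diagonal_mul]
    exact h.lift_injective (by rw [map_mul, ha', (hgD (i, j)).1])
  have hDG : D * G = D := by
    refine Matrix.ext fun i j => ?_
    rw [hG, Matrix.mul_diagonal]
    exact h.lift_injective (by rw [map_mul, ha', (hgD (i, j)).2])
  have hEG : Commute E G := by
    refine Matrix.ext fun i j => ?_
    rw [hG, Matrix.diagonal_mul, Matrix.mul_diagonal]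
    exact hEc a i j
  have hPG : Commute (E + D) G := hEG.add_left (hDG.trans hGD.symm)
  have hGfin : unitizationOp ι m G ∈ finiteRank (Fin m → X) := by
    rw [unitizationOp_eq]
    refine matrixOp_mem_finiteRank fun k l => ?_
    rw [Matrix.map_apply, hG, Matrix.diagonal_apply]
    split_ifs
    · rwa [ha']
    · rw [map_zero]
      exact zero_mem _
  rw [K0Unital.mk_sub_mk_eq hP hE hGG hPG hEG
    (by rw [add_mul, mul_sub D, hDG, mul_one, sub_self, add_zero])]
  have hmem : ∀ {S : Matrix (Fin m) (Fin m) (Unitization ℂ A)} (hS : IsIdempotentElem (S * G)),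
      K0Unital.mk (S * G) hS ∈ AddSubgroup.zmultiples (K0Unital.mk Q hQ) := by
    intro S hS
    rw [h.mk_eq_finrank_nsmul hS hQ (by rw [map_mul]; exact mul_mem_finiteRank_of_right _ hGfin)
      hQf hf]
    exact nsmul_mem (AddSubgroup.mem_zmultiples _) _
  exact sub_mem (hmem _) (hmem _)

/-- The generators of `K₀` are integral multiples of the class of a rank one idempotent. -/
theorem mk_sub_mk_scalarMap_mem [CompleteSpace X] (h : IsSingularIdeal ι) {m n : ℕ}
    {P : Matrix (Fin m) (Fin m) (Unitization ℂ A)} {Q : Matrix (Fin n) (Fin n) (Unitization ℂ A)}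
    (hP : IsIdempotentElem P) (hQ : IsIdempotentElem Q)
    {f : (Fin n → X) →L[ℂ] ℂ} {x : Fin n → X}
    (hQf : unitizationOp ι n Q = f.smulRight x) (hf : f x = 1) :
    K0Unital.mk P hP - K0Unital.mk ((scalarMap A).mapMatrix P)
      (isIdempotentElem_mapMatrix (scalarMap A) hP) ∈
        AddSubgroup.zmultiples (K0Unital.mk Q hQ) := by
  obtain ⟨P', hP', hPP', hfin⟩ := h.exists_equiv₀_finiteRank_perturbation hP
  rw [K0Unital.mk_eq_mk hP hP' hPP']
  obtain ⟨D, rfl⟩ : ∃ D, P' = (scalarMap A).mapMatrix P + D :=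
    ⟨P' - (scalarMap A).mapMatrix P, by abel⟩
  rw [add_sub_cancel_left] at hfin
  exact h.mk_sub_mk_mem_of_finiteRank hP' (isIdempotentElem_mapMatrix (scalarMap A) hP)
    (fun a i j => Algebra.commutes (P i j).fst a) hfin hQ hQf hf

/-- `K₀` is infinite cyclic, generated by the class of any idempotent of rank one. -/
theorem exists_int_addEquiv_K0 [CompleteSpace X] (h : IsSingularIdeal ι) {n : ℕ}
    {Q : Matrix (Fin n) (Fin n) A} (hQ : IsIdempotentElem Q)
    (hrank : Module.finrank ℂ
      (LinearMap.range (matrixOp (Q.map ι) : (Fin n → X) →ₗ[ℂ] (Fin n → X))) = 1) :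
    ∃ ω : ℤ ≃+ K0 A, ∀ ν : ℤ, ω ν = ν • K0.mk Q hQ := by
  have : IsStablyFiniteRing (Unitization ℂ A) := h.isStablyFiniteRing_unitization
  set Q' := matrixInr Q
  have hQ' : IsIdempotentElem Q' := isIdempotentElem_map_nonUnital _ hQ
  have hcoe : (K0.mk Q hQ : K0Unital (Unitization ℂ A)) = K0Unital.mk Q' hQ' := rfl
  rw [← unitizationOp_matrixInr] at hrank
  have hfin : unitizationOp ι n Q' ∈ finiteRank (Fin n → X) :=
    Module.finite_of_finrank_pos (by rw [hrank]; exact one_pos)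
  obtain ⟨b, β, hβ, hsum⟩ :=
    exists_biorthogonal_of_isIdempotentElem (hQ'.map (unitizationOp ι n)) hfin hrank
  rw [Fin.sum_univ_one] at hsum
  have hβ : β 0 (b 0) = 1 := by rw [hβ, if_pos rfl]
  have hQ0 : Q' ≠ 0 := by
    intro h0
    have h1 : (0 : (Fin n → X) →L[ℂ] (Fin n → X)) (b 0) = (β 0) (b 0) • b 0 := by
      rw [← map_zero (unitizationOp ι n), ← h0, hsum]
      rfl
    rw [hβ, one_smul] at h1
    rw [← h1] at hβ
    simp at hβ
  refine ⟨AddEquiv.ofBijective (zmultiplesHom (K0 A) (K0.mk Q hQ)) ⟨?_, ?_⟩, fun ν => rfl⟩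
  · refine (injective_iff_map_eq_zero _).2 fun ν hν => ?_
    by_contra hν0
    have hν' : ν • K0Unital.mk Q' hQ' = 0 := by
      rw [← hcoe]
      exact congrArg Subtype.val hν
    refine hQ0 (K0Unital.eq_zero_of_nsmul_mk_eq_zero (hQ := hQ') (Int.natAbs_ne_zero.2 hν0) ?_)
    rcases Int.natAbs_eq ν with hs | hs
    · rw [hs, natCast_zsmul] at hν'
      exact hν'
    · rw [hs, neg_zsmul, natCast_zsmul, neg_eq_zero] at hν'
      exact hν'
  · rintro ⟨_, m, P, hP, rfl⟩
    obtain ⟨ν, hν⟩ := h.mk_sub_mk_scalarMap_mem hP hQ' hsum hβ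
    exact ⟨ν, Subtype.ext hν⟩

end IsSingularIdeal

end K0

end OpK

theorem theorem3p7 (J : OpK.OperatorIdeal.{u}) (hclosed : J.Closed) (hJ : J.NonZero)
    (hsing : J.ContainedInStrictlySingular)
    (X : Type u) [NormedAddCommGroup X] [NormedSpace ℂ X] [OpK.InfDimBanach X]
    (n : ℕ) (Q : Matrix (Fin n) (Fin n) (OpK.finiteRank X)) (hQ : IsIdempotentElem Q)
    (hrank : Module.finrank ℂ
      (LinearMap.range (OpK.matrixOp (Q.map Subtype.val) :
        (Fin n → X) →ₗ[ℂ] (Fin n → X))) = 1) :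
    ∃ ω : ℤ ≃+ OpK.K0 (J.alg X), ∀ ν : ℤ, ω ν = ν • hJ.k0Class Q hQ :=
  (hsing.isSingularIdeal hJ X).exists_int_addEquiv_K0 _ hrank
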